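/- Let $\iota: M^m\to\mathbb R^{m+1}$ be a smooth oriented (immersed) hypersurface, with the induced Riemannian metric $g$, and let $\gamma=\eta: M\to \mathbb S^m$ be its Gauss map, that is, the smooth unit normal field of $M$; here the unit sphere $\mathbb S^m$ with its round metric is identified with the Grassmannian $G(m,1)$ of oriented hyperplanes of $\mathbb R^{m+1}$ by sending an oriented hyperplane to its unit normal. Let $A$ be the shape operator, $A(X)=-D_X\eta$, let $f=\frac1m\operatorname{trace}A$ be the mean curvature function (so that $H=f\eta$ is the mean curvature vector field), and let $|A|^2$ be the squared norm of $A$ with respect to $g$. Assume that $M$ is non-minimal, i.e. that $f$ does not vanish identically. Then the Gauss map $\gamma:(M,g)\to\mathbb S^m$ is proper biharmonic if and only if $\operatorname{grad} f$ is not identically zero and $$\Delta\operatorname{grad} f+A^2(\operatorname{grad} f)-|A|^2\operatorname{grad} f=0\quad\text{on } M.$$ Here $\Delta=-\operatorname{trace}\nabla^2$ is the rough Laplacian on vector fields of $(M,g)$, with $\nabla$ the Levi-Civita connection. A smooth map $\phi:(M,g)\to(N,h)$ is harmonic if its tension field $\tau(\phi)=\operatorname{trace}\nabla d\phi$ vanishes;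 it is biharmonic if $\tau_2(\phi)=-\Delta\tau(\phi)-\operatorname{trace}R^N(d\phi,\tau(\phi))d\phi$ vanishes, where $\Delta=-\operatorname{trace}\nabla^2$ is the rough Laplacian on sections of $\phi^{-1}(TN)$ and $R^N(X,Y)=\nabla_X\nabla_Y-\nabla_Y\nabla_X-\nabla_{[X,Y]}$; and it is proper biharmonic if it is biharmonic and not harmonic. -/

import Mathlib

open scoped Manifold ContDiff RealInnerProductSpace

namespace BiharmonicGauss

noncomputable section

/-- The Euclidean space `ℝⁿ`. -/
abbrev Euc (n : ℕ) : Type := EuclideanSpace ℝ (Fin n)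

/-! ### Riemannian geometry of maps in local coordinates

`G` and `H` are matrix functions `g_ij` and `h_αβ`, the coordinate expressions of the metrics of the
domain and of the target, and `u` is the coordinate expression of a map. -/

section Coordinates

variable {m n : ℕ}

/-- The partial derivative `∂_i u`. -/
def pd (i : Fin m) (u : Euc m → ℝ) (x : Euc m) : ℝ :=
  fderiv ℝ u x (EuclideanSpace.single i 1)

/-- The Christoffel symbol `Γ^k_ij` of the Levi-Civita connection of `G`. -/
def christoffel (G : Euc m → Matrix (Fin m) (Fin m) ℝ) (k i j : Fin m) (x : Euc m) : ℝ :=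
  (1 / 2) * ∑ l, (G x)⁻¹ k l *
    (pd i (fun y => G y j l) x + pd j (fun y => G y i l) x - pd l (fun y => G y i j) x)

/-- The component `R^l` of `R(∂_i, ∂_j) ∂_k = ∑ l, R^l ∂_l`, where
`R(X, Y) = ∇_X ∇_Y - ∇_Y ∇_X - ∇_[X, Y]`. -/
def curvatureCoeff (G : Euc m → Matrix (Fin m) (Fin m) ℝ) (l i j k : Fin m) (x : Euc m) : ℝ :=
  pd i (christoffel G l j k) x - pd j (christoffel G l i k) x
    + ∑ a, (christoffel G l i a x * christoffel G a j k x
        - christoffel G l j a x * christoffel G a i k x)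

/-- The curvature operator `R(X, Y) Z` at the point `x`. -/
def curvatureOp (G : Euc m → Matrix (Fin m) (Fin m) ℝ) (x : Euc m) (X Y Z : Euc m) : Euc m :=
  WithLp.toLp 2 fun l => ∑ i, ∑ j, ∑ k, curvatureCoeff G l i j k x * X i * Y j * Z k

/-- The section `∂_i u = du(∂_i)` along `u`. -/
def pdMap (u : Euc m → Euc n) (i : Fin m) (x : Euc m) : Euc n :=
  WithLp.toLp 2 fun α => pd i (fun y => u y α) x

/-- The covariant derivative `∇_{∂_i} V` of a section `V` along `u`, for the pull-back by `u` of the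
Levi-Civita connection of `H`. -/
def covDeriv (H : Euc n → Matrix (Fin n) (Fin n) ℝ) (u : Euc m → Euc n) (i : Fin m)
    (V : Euc m → Euc n) (x : Euc m) : Euc n :=
  WithLp.toLp 2 fun α => pd i (fun y => V y α) x
    + ∑ β, ∑ γ, christoffel H α β γ (u x) * pdMap u i x β * V x γ

/-- The rough Laplacian `Δ V = - trace ∇² V` of a section `V` along `u`. -/
def roughLaplacianCoord (G : Euc m → Matrix (Fin m) (Fin m) ℝ)
    (H : Euc n → Matrix (Fin n) (Fin n) ℝ) (u V : Euc m → Euc n) (x : Euc m) : Euc n :=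
  -∑ i, ∑ j, (G x)⁻¹ i j • (covDeriv H u i (covDeriv H u j V) x
    - ∑ k, christoffel G k i j x • covDeriv H u k V x)

/-- The tension field `τ(u) = trace ∇ du`. -/
def tensionCoord (G : Euc m → Matrix (Fin m) (Fin m) ℝ)
    (H : Euc n → Matrix (Fin n) (Fin n) ℝ) (u : Euc m → Euc n) (x : Euc m) : Euc n :=
  ∑ i, ∑ j, (G x)⁻¹ i j • (covDeriv H u i (pdMap u j) x
    - ∑ k, christoffel G k i j x • pdMap u k x)

/-- The bitension field `τ₂(u) = - Δ τ(u) - trace R(du, τ(u)) du`. -/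
def bitensionCoord (G : Euc m → Matrix (Fin m) (Fin m) ℝ)
    (H : Euc n → Matrix (Fin n) (Fin n) ℝ) (u : Euc m → Euc n) (x : Euc m) : Euc n :=
  -roughLaplacianCoord G H u (tensionCoord G H u) x
    - ∑ i, ∑ j, (G x)⁻¹ i j • curvatureOp H (u x) (pdMap u i x) (tensionCoord G H u x) (pdMap u j x)

end Coordinates

/-! ### Riemannian manifolds

Recall that a tangent vector at `p` is, in Mathlib, an element of the model space, namely the
vector of its coordinates in the preferred chart at `p`. -/

section Manifolds

variable {m n : ℕ} {M : Type*} [TopologicalSpace M] [ChartedSpace (Euc m) M]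
  {N : Type*} [TopologicalSpace N] [ChartedSpace (Euc n) N]

variable (m M) in
/-- A field of bilinear forms on the tangent spaces; used for Riemannian metrics. -/
abbrev MetricTensor : Type _ := (p : M) → LinearMap.BilinForm ℝ (TangentSpace (𝓡 m) p)

variable (m M) in
/-- Vector fields on `M`. -/
abbrev TangentField : Type _ := (p : M) → TangentSpace (𝓡 m) p

/-- The metric induced on `M` by an immersion `ι` in a Euclidean space. -/
def inducedMetric (ι : M → Euc n) : MetricTensor m M := fun p =>
  (innerₗ (Euc n)).compl₁₂ (mvfderiv (𝓡 m) ι p).toLinearMap (mvfderiv (𝓡 m) ι p).toLinearMap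

/-- The `i`-th vector of the coordinate basis of `T_p M` given by the preferred chart at `p`. -/
def basisVec (p : M) (i : Fin m) : TangentSpace (𝓡 m) p :=
  (EuclideanSpace.single i 1 : Euc m)

/-- The matrix of the metric at `p` in the basis `basisVec p`. -/
def gramAt (g : MetricTensor m M) (p : M) : Matrix (Fin m) (Fin m) ℝ :=
  Matrix.of fun i j => g p (basisVec p i) (basisVec p j)

/-- The vector `♯θ = ∑ g^ij θ(e_j) e_i`, for which `g(♯θ, v) = θ(v)`. -/
def sharp (g : MetricTensor m M) (p : M) (θ : TangentSpace (𝓡 m) p →ₗ[ℝ] ℝ) :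
    TangentSpace (𝓡 m) p :=
  ∑ i, ∑ j, ((gramAt g p)⁻¹ i j * θ (basisVec p j)) • basisVec p i

/-- The gradient of a function. -/
def grad (g : MetricTensor m M) (f : M → ℝ) : TangentField m M := fun p =>
  sharp g p (mvfderiv (𝓡 m) f p).toLinearMap

/-- The squared norm `|L|² = ∑ g^ij g(L e_i, L e_j)` of an endomorphism of `T_p M`. -/
def normSqEnd (g : MetricTensor m M) (p : M)
    (L : TangentSpace (𝓡 m) p →ₗ[ℝ] TangentSpace (𝓡 m) p) : ℝ :=
  ∑ i, ∑ j, (gramAt g p)⁻¹ i j * g p (L (basisVec p i)) (L (basisVec p j))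

/-- The coordinate expression `g_ij = g(∂_i, ∂_j)` of a metric in the preferred chart at `p`. -/
def metricInChart (g : MetricTensor m M) (p : M) (y : Euc m) : Matrix (Fin m) (Fin m) ℝ :=
  Matrix.of fun i j =>
    g ((extChartAt (𝓡 m) p).symm y)
      (mfderiv 𝓘(ℝ, Euc m) (𝓡 m) (extChartAt (𝓡 m) p).symm y (EuclideanSpace.single i (1 : ℝ)))
      (mfderiv 𝓘(ℝ, Euc m) (𝓡 m) (extChartAt (𝓡 m) p).symm y (EuclideanSpace.single j (1 : ℝ)))

/-- The coordinate expression of a vector field in the preferred chart at `p`. -/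
def fieldInChart (V : TangentField m M) (p : M) (y : Euc m) : Euc m :=
  mvfderiv (𝓡 m) (extChartAt (𝓡 m) p) ((extChartAt (𝓡 m) p).symm y)
    (V ((extChartAt (𝓡 m) p).symm y))

/-- The coordinate expression of a map in the preferred charts at `p` and `φ p`. -/
def mapInChart (φ : M → N) (p : M) (y : Euc m) : Euc n :=
  extChartAt (𝓡 n) (φ p) (φ ((extChartAt (𝓡 m) p).symm y))

/-- The rough Laplacian `Δ V = - trace ∇² V` on vector fields, `∇` being the Levi-Civita
connection of `g`. -/
def roughLaplacian (g : MetricTensor m M) (V : TangentField m M) : TangentField m M := fun p =>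
  roughLaplacianCoord (metricInChart g p) (metricInChart g p) id (fieldInChart V p)
    (extChartAt (𝓡 m) p p)

/-- The tension field of a map `φ : (M, g) → (N, h)`. -/
def tensionField (g : MetricTensor m M) (h : MetricTensor n N) (φ : M → N) (p : M) :
    TangentSpace (𝓡 n) (φ p) :=
  tensionCoord (metricInChart g p) (metricInChart h (φ p)) (mapInChart φ p) (extChartAt (𝓡 m) p p)

/-- The bitension field of a map `φ : (M, g) → (N, h)`. -/
def bitensionField (g : MetricTensor m M) (h : MetricTensor n N) (φ : M → N) (p : M) :
    TangentSpace (𝓡 n) (φ p) :=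
  bitensionCoord (metricInChart g p) (metricInChart h (φ p)) (mapInChart φ p)
    (extChartAt (𝓡 m) p p)

/-- Harmonic maps. -/
def IsHarmonic (g : MetricTensor m M) (h : MetricTensor n N) (φ : M → N) : Prop :=
  ContMDiff (𝓡 m) (𝓡 n) ∞ φ ∧ ∀ p, tensionField g h φ p = 0

/-- Biharmonic maps. -/
def IsBiharmonic (g : MetricTensor m M) (h : MetricTensor n N) (φ : M → N) : Prop :=
  ContMDiff (𝓡 m) (𝓡 n) ∞ φ ∧ ∀ p, bitensionField g h φ p = 0

/-- Proper biharmonic maps: biharmonic and not harmonic. -/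
def IsProperBiharmonic (g : MetricTensor m M) (h : MetricTensor n N) (φ : M → N) : Prop :=
  IsBiharmonic g h φ ∧ ¬ IsHarmonic g h φ

end Manifolds

/-! ### Oriented hypersurfaces of Euclidean space -/

section Hypersurfaces

variable {m : ℕ} {M : Type*} [TopologicalSpace M] [ChartedSpace (Euc m) M]

/-- The unit sphere `Sᵐ` of `ℝ^(m+1)`. It is the Grassmannian `G(m, 1)` of oriented hyperplanes:
an oriented hyperplane `P` corresponds to its unit normal `η`, and `T_P G(m, 1) = Hom(P, P^⊥)`, with
the metric for which the `e_i^* ⊗ η` are orthonormal, corresponds to `T_η Sᵐ = η^⊥ = P`. -/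
abbrev UnitSphere (m : ℕ) : Type := Metric.sphere (0 : Euc (m + 1)) 1

/-- The round metric of the unit sphere. -/
def sphereMetric (m : ℕ) : MetricTensor m (UnitSphere m) :=
  inducedMetric (fun q : UnitSphere m => (q : Euc (m + 1)))

/-- `ι` is a smooth immersion of `M` as a hypersurface of `ℝ^(m+1)`. -/
def IsHypersurface (ι : M → Euc (m + 1)) : Prop :=
  ContMDiff (𝓡 m) 𝓘(ℝ, Euc (m + 1)) ∞ ι ∧ ∀ p, Function.Injective (mvfderiv (𝓡 m) ι p)

/-- `η` is the Gauss map of the hypersurface `ι`, for one of its orientations: a smooth map to the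
unit sphere for which `η p` is normal to the hypersurface at `p`. -/
def IsGaussMap (ι : M → Euc (m + 1)) (η : M → UnitSphere m) : Prop :=
  ContMDiff (𝓡 m) (𝓡 m) ∞ η ∧
    ∀ p (v : TangentSpace (𝓡 m) p), ⟪mvfderiv (𝓡 m) ι p v, (η p : Euc (m + 1))⟫ = 0

/-- The shape operator: `A v` is the tangent vector `- D_v η`, that is
`g(A v, w) = - ⟪D_v η, dι w⟫` for all `w`. -/
def shapeOperator (ι : M → Euc (m + 1)) (η : M → UnitSphere m) (p : M) :
    TangentSpace (𝓡 m) p →ₗ[ℝ] TangentSpace (𝓡 m) p where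
  toFun v := sharp (inducedMetric ι) p
    (-(innerₗ (Euc (m + 1)) (mvfderiv (𝓡 m) (fun q => (η q : Euc (m + 1))) p v)
      ∘ₗ (mvfderiv (𝓡 m) ι p).toLinearMap))
  map_add' v w := by
    simp only [sharp, LinearMap.neg_apply, LinearMap.comp_apply, map_add, LinearMap.add_apply,
      neg_add, mul_add, add_smul, Finset.sum_add_distrib]
  map_smul' c v := by
    simp only [sharp, LinearMap.neg_apply, LinearMap.comp_apply, map_smul, LinearMap.smul_apply,
      smul_eq_mul, RingHom.id_apply, Finset.smul_sum, smul_smul]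
    refine Finset.sum_congr rfl fun i _ => Finset.sum_congr rfl fun j _ => ?_
    congr 1
    ring

/-- The mean curvature function `f = (1/m) trace A`; the mean curvature vector field is `f η`. -/
def meanCurvature (ι : M → Euc (m + 1)) (η : M → UnitSphere m) (p : M) : ℝ :=
  (1 / (m : ℝ)) * LinearMap.trace ℝ (TangentSpace (𝓡 m) p) (shapeOperator ι η p)

/-- The hypersurface is minimal: its mean curvature vanishes identically. -/
def IsMinimal (ι : M → Euc (m + 1)) (η : M → UnitSphere m) : Prop :=
  ∀ p, meanCurvature ι η p = 0

end Hypersurfaces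

end

end BiharmonicGauss

/-! Everything is computed inside `ℝ^(m+1)`. Write `Ψ` for the inclusion of the sphere. Its unit
normal at a point is the point itself, so `dΨ` maps the tangent space of the sphere at `η p` onto
the orthogonal complement of `η p`, which is also the image of `dι` at `p`. Hence the pull-back of
the tangent bundle of the sphere by `η` and the tangent bundle of `M` are the same subbundle of the
trivial bundle. By the Gauss formula both connections are the flat derivative followed by orthogonal
projection (`fderiv_covDeriv`), so under this identification the two rough Laplacians agree.

The Codazzi equation gives the tension field: the trace of `∇dη`, paired with `dι(e_l)`, is the
`l`-th derivative of `trace dη`, and this trace is `-m f`. Thus `dΨ(τ) = -m dι(grad f)`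
(`fderiv_tensionField`), and `η` is harmonic exactly when `grad f = 0`.

For the bitension field, `-Δτ` becomes `m Δ grad f`. The sphere has `R(X, Y)Z = ⟪Y, Z⟫ X - ⟪X, Z⟫
Y`, by commuting third derivatives of `Ψ`. Since `dη = -dι ∘ A` with `A` self-adjoint, the curvature
term becomes `m (A² grad f - |A|² grad f)` (`sum_inner_smul_partialD_normal`). So `dΨ(τ₂)` is `m`
times `dι` of the left-hand side of the equation (`fderiv_bitensionField`); as `dι` and `dΨ` are
injective and `m ≠ 0`, the two vanish together. -/

namespace BiharmonicGauss

noncomputable section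

/-! ### Calculus of partial derivatives on open subsets of Euclidean space. -/

section PartialDerivatives

variable {m n : ℕ} {E : Type*} [NormedAddCommGroup E] [NormedSpace ℝ E]

/-- The partial derivative `∂_i F` of a vector-valued function. -/
def partialD (i : Fin m) (F : Euc m → E) (x : Euc m) : E :=
  fderiv ℝ F x (EuclideanSpace.single i 1)

theorem pd_eq_partialD (i : Fin m) (u : Euc m → ℝ) : pd i u = partialD i u := rfl

theorem partialD_congr {U : Set (Euc m)} (hU : IsOpen U) {F F' : Euc m → E}
    (h : Set.EqOn F F' U) (i : Fin m) {x : Euc m} (hx : x ∈ U) :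
    partialD i F x = partialD i F' x := by
  unfold partialD
  rw [(h.eventuallyEq_of_mem (hU.mem_nhds hx)).fderiv_eq]

theorem contDiffOn_partialD {U : Set (Euc m)} (hU : IsOpen U) {F : Euc m → E}
    (hF : ContDiffOn ℝ ∞ F U) (i : Fin m) : ContDiffOn ℝ ∞ (partialD i F) U :=
  (hF.fderiv_of_isOpen hU (by simp)).clm_apply contDiffOn_const

theorem differentiableAt_of_contDiffOn {U : Set (Euc m)} (hU : IsOpen U) {F : Euc m → E}
    (hF : ContDiffOn ℝ ∞ F U) {x : Euc m} (hx : x ∈ U) : DifferentiableAt ℝ F x :=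
  (hF.contDiffAt (hU.mem_nhds hx)).differentiableAt (by simp)

theorem fderiv_eq_sum_partialD (F : Euc m → E) (x v : Euc m) :
    fderiv ℝ F x v = ∑ i, v i • partialD i F x := by
  have h : v = ∑ i, v i • (EuclideanSpace.single i (1 : ℝ) : Euc m) := by
    conv_lhs => rw [← (EuclideanSpace.basisFun (Fin m) ℝ).sum_repr v]
    simp
  conv_lhs => rw [h]
  simp [partialD]

theorem partialD_sum {ι : Type*} (s : Finset ι) {F : ι → Euc m → E} {x : Euc m}
    (hF : ∀ a ∈ s, DifferentiableAt ℝ (F a) x) (i : Fin m) :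
    partialD i (fun y => ∑ a ∈ s, F a y) x = ∑ a ∈ s, partialD i (F a) x := by
  unfold partialD
  rw [fderiv_fun_sum hF]
  simp

theorem partialD_smul {c : Euc m → ℝ} {F : Euc m → E} {x : Euc m}
    (hc : DifferentiableAt ℝ c x) (hF : DifferentiableAt ℝ F x) (i : Fin m) :
    partialD i (fun y => c y • F y) x = partialD i c x • F x + c x • partialD i F x := by
  unfold partialD
  rw [fderiv_fun_smul hc hF]
  simp [add_comm]

theorem partialD_sub {F F' : Euc m → E} {x : Euc m}
    (hF : DifferentiableAt ℝ F x) (hF' : DifferentiableAt ℝ F' x) (i : Fin m) :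
    partialD i (fun y => F y - F' y) x = partialD i F x - partialD i F' x := by
  unfold partialD
  rw [fderiv_fun_sub hF hF']
  simp

theorem partialD_mul {c d : Euc m → ℝ} {x : Euc m}
    (hc : DifferentiableAt ℝ c x) (hd : DifferentiableAt ℝ d x) (i : Fin m) :
    partialD i (fun y => c y * d y) x = partialD i c x * d x + c x * partialD i d x :=
  partialD_smul hc hd i

theorem partialD_const (c : E) (i : Fin m) (x : Euc m) :
    partialD i (fun _ => c) x = 0 := by
  simp [partialD]

theorem partialD_inner {E : Type*} [NormedAddCommGroup E] [InnerProductSpace ℝ E]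
    {F F' : Euc m → E} {x : Euc m}
    (hF : DifferentiableAt ℝ F x) (hF' : DifferentiableAt ℝ F' x) (i : Fin m) :
    partialD i (fun y => ⟪F y, F' y⟫) x = ⟪partialD i F x, F' x⟫ + ⟪F x, partialD i F' x⟫ := by
  unfold partialD
  rw [fderiv_inner_apply ℝ hF hF', add_comm]

theorem partialD_comm {U : Set (Euc m)} (hU : IsOpen U) {F : Euc m → E}
    (hF : ContDiffOn ℝ ∞ F U) (i j : Fin m) {x : Euc m} (hx : x ∈ U) :
    partialD i (partialD j F) x = partialD j (partialD i F) x := by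
  have hd : DifferentiableAt ℝ (fderiv ℝ F) x :=
    differentiableAt_of_contDiffOn hU (hF.fderiv_of_isOpen hU (by simp)) hx
  have hs : IsSymmSndFDerivAt ℝ F x :=
    (hF.contDiffAt (hU.mem_nhds hx)).isSymmSndFDerivAt
      (by simpa using (WithTop.coe_le_coe.2 (le_top : (2 : ℕ∞) ≤ ⊤)))
  have key : ∀ k l : Fin m, partialD k (partialD l F) x =
      fderiv ℝ (fderiv ℝ F) x (EuclideanSpace.single k 1) (EuclideanSpace.single l 1) := by
    intro k l
    unfold partialD
    rw [fderiv_clm_apply hd (differentiableAt_const _)]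
    simp
  rw [key, key, hs]

theorem partialD_comp {F : Euc n → E} {u : Euc m → Euc n} {x : Euc m}
    (hF : DifferentiableAt ℝ F (u x)) (hu : DifferentiableAt ℝ u x) (i : Fin m) :
    partialD i (fun y => F (u y)) x = fderiv ℝ F (u x) (partialD i u x) := by
  unfold partialD
  have := fderiv_comp x hF hu
  rw [show (fun y => F (u y)) = F ∘ u from rfl, this]
  rfl

theorem pd_coord {V : Euc m → Euc n} {x : Euc m} (hV : DifferentiableAt ℝ V x) (i : Fin m)
    (α : Fin n) : pd i (fun y => V y α) x = partialD i V x α := by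
  have h := ((EuclideanSpace.proj (𝕜 := ℝ) α : Euc n →L[ℝ] ℝ).hasFDerivAt.comp x
    hV.hasFDerivAt).fderiv
  unfold pd partialD
  rw [show (fun y => V y α) = (EuclideanSpace.proj (𝕜 := ℝ) α : Euc n →L[ℝ] ℝ) ∘ V from rfl, h]
  rfl

theorem pdMap_eq_partialD {V : Euc m → Euc n} {x : Euc m} (hV : DifferentiableAt ℝ V x)
    (i : Fin m) : pdMap V i x = partialD i V x := by
  ext α
  exact pd_coord hV i α

theorem contDiffOn_coord {U : Set (Euc m)} {V : Euc m → Euc n} (hV : ContDiffOn ℝ ∞ V U)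
    (α : Fin n) : ContDiffOn ℝ ∞ (fun y => V y α) U :=
  (EuclideanSpace.proj (𝕜 := ℝ) α : Euc n →L[ℝ] ℝ).contDiff.comp_contDiffOn hV

theorem contDiffOn_of_coord {U : Set (Euc m)} {V : Euc m → Euc n}
    (hV : ∀ α, ContDiffOn ℝ ∞ (fun y => V y α) U) : ContDiffOn ℝ ∞ V U :=
  contDiffOn_euclidean.2 hV

/-- Cramer's rule: an entry of the inverse is an entry of the adjugate, itself a determinant,
divided by the determinant. -/
theorem contDiffOn_matrix_inv {U : Set (Euc m)} {G : Euc m → Matrix (Fin n) (Fin n) ℝ}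
    (hG : ∀ i j, ContDiffOn ℝ ∞ (fun y => G y i j) U) (hdet : ∀ y ∈ U, (G y).det ≠ 0)
    (i j : Fin n) : ContDiffOn ℝ ∞ (fun y => (G y)⁻¹ i j) U := by
  have hd : ∀ G' : Euc m → Matrix (Fin n) (Fin n) ℝ,
      (∀ i j, ContDiffOn ℝ ∞ (fun y => G' y i j) U) →
        ContDiffOn ℝ ∞ (fun y => (G' y).det) U := by
    intro G' h'
    simp only [Matrix.det_apply]
    exact ContDiffOn.sum fun σ _ => (contDiffOn_prod fun k _ => h' _ _).const_smul _
  have ha : ContDiffOn ℝ ∞ (fun y => (G y).adjugate i j) U := by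
    simp only [Matrix.adjugate_apply]
    refine hd _ fun k l => ?_
    by_cases hk : k = j
    · subst hk; simpa using contDiffOn_const
    · simpa [Matrix.updateRow_ne hk] using hG k l
  have : ContDiffOn ℝ ∞ (fun y => ((G y).det)⁻¹ * (G y).adjugate i j) U :=
    ((hd G hG).inv hdet).mul ha
  refine this.congr fun y _ => ?_
  simp [Matrix.inv_def]

theorem contDiffOn_christoffel {U : Set (Euc m)} (hU : IsOpen U)
    {G : Euc m → Matrix (Fin m) (Fin m) ℝ}
    (hG : ∀ i j, ContDiffOn ℝ ∞ (fun y => G y i j) U) (hdet : ∀ y ∈ U, (G y).det ≠ 0)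
    (k i j : Fin m) : ContDiffOn ℝ ∞ (christoffel G k i j) U := by
  have hp : ∀ a b c, ContDiffOn ℝ ∞ (pd a fun y => G y b c) U := fun a b c =>
    contDiffOn_partialD hU (hG b c) a
  unfold christoffel
  exact contDiffOn_const.mul (ContDiffOn.sum fun l _ =>
    (contDiffOn_matrix_inv hG hdet k l).mul (((hp i j l).add (hp j i l)).sub (hp l i j)))

end PartialDerivatives

/-! ### Projection along a unit normal. -/

section TangentialProjection

variable {E : Type*} [NormedAddCommGroup E] [InnerProductSpace ℝ E]

/-- The projection `w ↦ w - ⟪n, w⟫ n`, orthogonal to `n` when `n` is a unit vector. -/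
def tproj (n : E) : E →ₗ[ℝ] E := LinearMap.id - (innerₗ E n).smulRight n

theorem tproj_apply (n w : E) : tproj n w = w - ⟪n, w⟫ • n := rfl

theorem tproj_of_orthogonal {n w : E} (h : ⟪n, w⟫ = 0) : tproj n w = w := by
  simp [tproj_apply, h]

theorem inner_tproj {n : E} (w : E) {v : E} (h : ⟪v, n⟫ = 0) : ⟪v, tproj n w⟫ = ⟪v, w⟫ := by
  simp [tproj_apply, inner_sub_right, inner_smul_right, h]

theorem inner_tproj_self {n : E} (hn : ⟪n, n⟫ = 1) (w : E) : ⟪n, tproj n w⟫ = 0 := by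
  simp only [tproj_apply, inner_sub_right, inner_smul_right, hn]
  ring

theorem tproj_self {n : E} (hn : ⟪n, n⟫ = 1) : tproj n n = 0 := by
  simp only [tproj_apply, hn, one_smul, sub_self]

end TangentialProjection

/-! ### Linear algebra in a non-orthonormal basis, through its Gram matrix. -/

section Gram

variable {n : ℕ} {E : Type*} [NormedAddCommGroup E] [InnerProductSpace ℝ E]

theorem det_gram_ne_zero {v : Fin n → E} (hv : LinearIndependent ℝ v) :
    (Matrix.gram ℝ v).det ≠ 0 :=
  (Matrix.posDef_gram_of_linearIndependent hv).det_pos.ne'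

theorem gram_inv_symm (v : Fin n → E) (i j : Fin n) :
    (Matrix.gram ℝ v)⁻¹ i j = (Matrix.gram ℝ v)⁻¹ j i := by
  have h := (Matrix.isHermitian_gram ℝ v).inv.apply j i
  simpa using h

theorem gram_mul_inv_apply {v : Fin n → E} (hv : LinearIndependent ℝ v) (i k : Fin n) :
    ∑ j, ⟪v i, v j⟫ * (Matrix.gram ℝ v)⁻¹ j k = if i = k then 1 else 0 := by
  have h := congrFun (congrFun (Matrix.mul_nonsing_inv (Matrix.gram ℝ v)
    (det_gram_ne_zero hv).isUnit) i) k
  simpa [Matrix.mul_apply, Matrix.gram_apply, Matrix.one_apply] using h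

theorem inner_sum_gram_inv {v : Fin n → E} (hv : LinearIndependent ℝ v) (θ : Fin n → ℝ)
    (i : Fin n) :
    ⟪v i, ∑ k, ∑ l, ((Matrix.gram ℝ v)⁻¹ k l * θ l) • v k⟫ = θ i := by
  simp only [inner_sum, inner_smul_right]
  rw [Finset.sum_comm]
  have : ∀ l, ∑ k, (Matrix.gram ℝ v)⁻¹ k l * θ l * ⟪v i, v k⟫ =
      (if i = l then 1 else 0) * θ l := by
    intro l
    rw [← gram_mul_inv_apply hv i l, Finset.sum_mul]
    exact Finset.sum_congr rfl fun k _ => by ring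
  simp [this]

theorem eq_of_inner_basis_eq {v : Fin n → E} {a b : E}
    (ha : a ∈ Submodule.span ℝ (Set.range v)) (hb : b ∈ Submodule.span ℝ (Set.range v))
    (h : ∀ i, ⟪v i, a⟫ = ⟪v i, b⟫) : a = b := by
  have hmem : a - b ∈ (Submodule.span ℝ (Set.range v))ᗮ := by
    rw [Submodule.mem_orthogonal]
    intro u hu
    induction hu using Submodule.span_induction with
    | mem x hx => obtain ⟨i, rfl⟩ := hx; rw [inner_sub_right, h, sub_self]
    | zero => simp
    | add x y _ _ hx hy => rw [inner_add_left, hx, hy, add_zero]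
    | smul c x _ hx => rw [inner_smul_left, hx, mul_zero]
  have := Submodule.inner_right_of_mem_orthogonal (Submodule.sub_mem _ ha hb) hmem
  exact sub_eq_zero.1 (inner_self_eq_zero.1 this)

theorem eq_sum_gram_inv {v : Fin n → E} (hv : LinearIndependent ℝ v) {w : E}
    (hw : w ∈ Submodule.span ℝ (Set.range v)) :
    w = ∑ k, ∑ l, ((Matrix.gram ℝ v)⁻¹ k l * ⟪v l, w⟫) • v k := by
  refine eq_of_inner_basis_eq hw ?_ fun i => (inner_sum_gram_inv hv (fun l => ⟪v l, w⟫) i).symm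
  exact Submodule.sum_mem _ fun k _ => Submodule.sum_mem _ fun l _ =>
    Submodule.smul_mem _ _ (Submodule.subset_span ⟨k, rfl⟩)

/-- Codimension one enters here: `N` and the `v i` are `n + 1` independent vectors, hence a basis,
and orthogonality to `N` kills the coefficient of `N`. -/
theorem mem_span_of_inner_normal_eq_zero {v : Fin n → Euc (n + 1)} (hv : LinearIndependent ℝ v)
    {N : Euc (n + 1)} (hN : ⟪N, N⟫ = 1) (horth : ∀ i, ⟪N, v i⟫ = 0) {w : Euc (n + 1)}
    (hw : ⟪N, w⟫ = 0) : w ∈ Submodule.span ℝ (Set.range v) := by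
  have hperp : ∀ u ∈ Submodule.span ℝ (Set.range v), ⟪N, u⟫ = 0 := by
    intro u hu
    induction hu using Submodule.span_induction with
    | mem x hx => obtain ⟨i, rfl⟩ := hx; exact horth i
    | zero => simp
    | add x z _ _ hx hz => rw [inner_add_right, hx, hz, add_zero]
    | smul c x _ hx => rw [inner_smul_right, hx, mul_zero]
  have hmem : N ∉ Submodule.span ℝ (Set.range v) := fun hmem => by
    have := hperp _ hmem
    rw [hN] at this
    exact one_ne_zero this
  have hli : LinearIndependent ℝ (Fin.cons N v : Fin (n + 1) → Euc (n + 1)) :=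
    linearIndependent_finCons.2 ⟨hv, hmem⟩
  have htop := hli.span_eq_top_of_card_eq_finrank (by simp)
  rw [Fin.range_cons] at htop
  have hw' : w ∈ Submodule.span ℝ (insert N (Set.range v)) := by
    rw [htop]; trivial
  obtain ⟨a, z, hz, rfl⟩ := Submodule.mem_span_insert.1 hw'
  have ha : a = 0 := by
    rw [inner_add_right, inner_smul_right, hN, hperp z hz] at hw
    linarith
  simpa [ha] using hz

/-- The inner product is taken after the injection `T`, so `V` needs none of its own. With `V` a
tangent space and `T = dι`, this turns the trace defining the mean curvature into a contraction with
the inverse metric. -/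
theorem trace_eq_sum_gram_inv {V : Type*} [AddCommGroup V] [Module ℝ V]
    (b : Module.Basis (Fin n) ℝ V)
    (T : V →ₗ[ℝ] E) (hT : LinearIndependent ℝ fun i => T (b i)) (L : V →ₗ[ℝ] V) :
    LinearMap.trace ℝ V L =
      ∑ i, ∑ j, (Matrix.gram ℝ fun i => T (b i))⁻¹ i j * ⟪T (L (b i)), T (b j)⟫ := by
  rw [LinearMap.trace_eq_matrix_trace ℝ b, Matrix.trace]
  refine Finset.sum_congr rfl fun i _ => ?_
  have h1 : T (L (b i)) = ∑ l, b.repr (L (b i)) l • T (b l) := by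
    conv_lhs => rw [← b.sum_repr (L (b i)), map_sum]
    simp only [map_smul]
  simp only [Matrix.diag_apply, LinearMap.toMatrix_apply, h1, sum_inner, real_inner_smul_left,
    Finset.mul_sum]
  rw [Finset.sum_comm]
  have h2 : ∀ l, ∑ j, (Matrix.gram ℝ fun i => T (b i))⁻¹ i j *
      (b.repr (L (b i)) l * ⟪T (b l), T (b j)⟫) = b.repr (L (b i)) l * if l = i then 1 else 0 := by
    intro l
    rw [← gram_mul_inv_apply hT l i, Finset.mul_sum]
    refine Finset.sum_congr rfl fun j _ => ?_
    rw [gram_inv_symm]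
    ring
  simp [h2]

end Gram

theorem linearIndependent_apply_single {n : ℕ} {E : Type*} [NormedAddCommGroup E]
    [NormedSpace ℝ E]
    (D : Euc n →L[ℝ] E) (hD : Function.Injective D) :
    LinearIndependent ℝ fun i => D (EuclideanSpace.single i 1) := by
  have hb := ((EuclideanSpace.basisFun (Fin n) ℝ).toBasis.linearIndependent).map'
    D.toLinearMap (LinearMap.ker_eq_bot.2 hD)
  have he : (fun i => D (EuclideanSpace.single i 1)) =
      D.toLinearMap ∘ (EuclideanSpace.basisFun (Fin n) ℝ).toBasis := by
    ext i
    simp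
  rw [he]
  exact hb

/-! ### Hypersurface patches and the Gauss formula. -/

section UnitNormal

variable {m n : ℕ}

/-- On the open set `U`, `F` is a smooth immersion of codimension one, and `N` a smooth unit normal
field of `F`. -/
structure UnitNormalOn (U : Set (Euc n)) (F N : Euc n → Euc (n + 1)) : Prop where
  isOpen : IsOpen U
  contDiffOn : ContDiffOn ℝ ∞ F U
  contDiffOn_normal : ContDiffOn ℝ ∞ N U
  inner_normal : ∀ y ∈ U, ⟪N y, N y⟫ = 1
  orthogonal : ∀ y ∈ U, ∀ i, ⟪N y, partialD i F y⟫ = 0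
  injective : ∀ y ∈ U, Function.Injective (fderiv ℝ F y)

/-- The matrix of the metric induced by `F`. -/
def gramOf (F : Euc n → Euc (m + 1)) (y : Euc n) : Matrix (Fin n) (Fin n) ℝ :=
  Matrix.gram ℝ fun i => partialD i F y

theorem gramOf_apply (F : Euc n → Euc (m + 1)) (y : Euc n) (i j : Fin n) :
    gramOf F y i j = ⟪partialD i F y, partialD j F y⟫ := rfl

namespace UnitNormalOn

variable {U : Set (Euc n)} {F N : Euc n → Euc (n + 1)}

theorem mono_congr (h : UnitNormalOn U F N) {U' : Set (Euc n)} (hU' : IsOpen U') (hsub : U' ⊆ U)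
    {N' : Euc n → Euc (n + 1)} (hN : Set.EqOn N' N U') : UnitNormalOn U' F N' where
  isOpen := hU'
  contDiffOn := h.contDiffOn.mono hsub
  contDiffOn_normal := (h.contDiffOn_normal.mono hsub).congr hN
  inner_normal y hy := by rw [hN hy]; exact h.inner_normal y (hsub hy)
  orthogonal y hy i := by rw [hN hy]; exact h.orthogonal y (hsub hy) i
  injective y hy := h.injective y (hsub hy)

theorem linearIndependent (h : UnitNormalOn U F N) {y : Euc n} (hy : y ∈ U) :
    LinearIndependent ℝ fun i => partialD i F y :=
  linearIndependent_apply_single _ (h.injective y hy)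

theorem differentiableAt (h : UnitNormalOn U F N) {y : Euc n} (hy : y ∈ U) :
    DifferentiableAt ℝ F y := differentiableAt_of_contDiffOn h.isOpen h.contDiffOn hy

theorem differentiableAt_normal (h : UnitNormalOn U F N) {y : Euc n} (hy : y ∈ U) :
    DifferentiableAt ℝ N y := differentiableAt_of_contDiffOn h.isOpen h.contDiffOn_normal hy

theorem contDiffOn_partialD (h : UnitNormalOn U F N) (i : Fin n) :
    ContDiffOn ℝ ∞ (partialD i F) U := BiharmonicGauss.contDiffOn_partialD h.isOpen h.contDiffOn i

theorem differentiableAt_partialD (h : UnitNormalOn U F N) (i : Fin n) {y : Euc n} (hy : y ∈ U) :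
    DifferentiableAt ℝ (partialD i F) y :=
  differentiableAt_of_contDiffOn h.isOpen (h.contDiffOn_partialD i) hy

theorem inner_normal_fderiv (h : UnitNormalOn U F N) {y : Euc n} (hy : y ∈ U) (v : Euc n) :
    ⟪N y, fderiv ℝ F y v⟫ = 0 := by
  simp [fderiv_eq_sum_partialD, inner_sum, inner_smul_right, h.orthogonal y hy]

theorem tproj_fderiv (h : UnitNormalOn U F N) {y : Euc n} (hy : y ∈ U) (v : Euc n) :
    tproj (N y) (fderiv ℝ F y v) = fderiv ℝ F y v :=
  tproj_of_orthogonal (h.inner_normal_fderiv hy v)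

theorem mem_span (h : UnitNormalOn U F N) {y : Euc n} (hy : y ∈ U) {w : Euc (n + 1)}
    (hw : ⟪N y, w⟫ = 0) : w ∈ Submodule.span ℝ (Set.range fun i => partialD i F y) :=
  mem_span_of_inner_normal_eq_zero (h.linearIndependent hy) (h.inner_normal y hy)
    (h.orthogonal y hy) hw

theorem det_gramOf_ne_zero (h : UnitNormalOn U F N) {y : Euc n} (hy : y ∈ U) :
    (gramOf F y).det ≠ 0 := det_gram_ne_zero (h.linearIndependent hy)

theorem contDiffOn_gramOf (h : UnitNormalOn U F N) (i j : Fin n) :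
    ContDiffOn ℝ ∞ (fun y => gramOf F y i j) U :=
  (h.contDiffOn_partialD i).inner ℝ (h.contDiffOn_partialD j)

theorem partialD_gramOf (h : UnitNormalOn U F N) {y : Euc n} (hy : y ∈ U) (l i j : Fin n) :
    partialD l (fun y => gramOf F y i j) y =
      ⟪partialD l (partialD i F) y, partialD j F y⟫
        + ⟪partialD i F y, partialD l (partialD j F) y⟫ :=
  partialD_inner (h.differentiableAt_partialD i hy) (h.differentiableAt_partialD j hy) l

variable {G : Euc n → Matrix (Fin n) (Fin n) ℝ}

theorem contDiffOn_metric (h : UnitNormalOn U F N) (hG : Set.EqOn G (gramOf F) U) (i j : Fin n) :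
    ContDiffOn ℝ ∞ (fun y => G y i j) U :=
  (h.contDiffOn_gramOf i j).congr fun y hy => by rw [hG hy]

theorem contDiffOn_christoffel (h : UnitNormalOn U F N) (hG : Set.EqOn G (gramOf F) U)
    (k i j : Fin n) : ContDiffOn ℝ ∞ (christoffel G k i j) U :=
  BiharmonicGauss.contDiffOn_christoffel h.isOpen (h.contDiffOn_metric hG)
    (fun y hy => by rw [hG hy]; exact h.det_gramOf_ne_zero hy) k i j

/-- Gauss formula. Expanding the derivatives of the Gram entries by the product rule and commuting
second partials, all terms of the Koszul combination cancel except twice `⟪∂_i ∂_j F, ∂_l F⟫`;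
raising the index `l` recovers the tangential part. -/
theorem sum_christoffel_smul (h : UnitNormalOn U F N) (hG : Set.EqOn G (gramOf F) U)
    {y : Euc n} (hy : y ∈ U) (i j : Fin n) :
    ∑ k, christoffel G k i j y • partialD k F y =
      tproj (N y) (partialD i (partialD j F) y) := by
  have hw : ⟪N y, tproj (N y) (partialD i (partialD j F) y)⟫ = 0 :=
    inner_tproj_self (h.inner_normal y hy) _
  rw [eq_sum_gram_inv (h.linearIndependent hy) (h.mem_span hy hw)]
  refine Finset.sum_congr rfl fun k _ => ?_
  rw [← Finset.sum_smul]
  congr 1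
  unfold christoffel
  rw [Finset.mul_sum]
  refine Finset.sum_congr rfl fun l _ => ?_
  have hp : ∀ a b c, pd a (fun y => G y b c) y =
      ⟪partialD a (partialD b F) y, partialD c F y⟫
        + ⟪partialD b F y, partialD a (partialD c F) y⟫ := fun a b c => by
    rw [pd_eq_partialD, ← h.partialD_gramOf hy]
    exact partialD_congr h.isOpen (fun z hz => by simp only [hG hz]) a hy
  rw [hp, hp, hp, hG hy, inner_tproj _ (by rw [real_inner_comm]; exact h.orthogonal y hy l),
    partialD_comm h.isOpen h.contDiffOn j i hy, partialD_comm h.isOpen h.contDiffOn l i hy,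
    partialD_comm h.isOpen h.contDiffOn l j hy,
    real_inner_comm (partialD l F y), real_inner_comm (partialD j F y)]
  change _ = (gramOf F y)⁻¹ k l * _
  ring

end UnitNormalOn

end UnitNormal

/-! ### Intrinsic covariant derivatives as projected flat derivatives. -/

section PushForward

variable {m n : ℕ}

theorem contDiffOn_pdMap {U : Set (Euc m)} (hU : IsOpen U) {u : Euc m → Euc n}
    (hu : ContDiffOn ℝ ∞ u U) (i : Fin m) : ContDiffOn ℝ ∞ (pdMap u i) U :=
  (contDiffOn_partialD hU hu i).congr fun _ hy =>
    pdMap_eq_partialD (differentiableAt_of_contDiffOn hU hu hy) i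

/-- The tangential derivative of a vector field `W` along a map with unit normal `ν`. -/
def tangentD (ν : Euc m → Euc (n + 1)) (i : Fin m) (W : Euc m → Euc (n + 1)) (x : Euc m) :
    Euc (n + 1) :=
  tproj (ν x) (partialD i W x)

/-- The trace of the second covariant derivative, for the tangential connection. -/
def tangentLaplacian (G : Euc m → Matrix (Fin m) (Fin m) ℝ) (ν W : Euc m → Euc (n + 1))
    (x : Euc m) : Euc (n + 1) :=
  ∑ i, ∑ j, (G x)⁻¹ i j • (tangentD ν i (tangentD ν j W) x
    - ∑ k, christoffel G k i j x • tangentD ν k W x)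

theorem tangentD_congr {U : Set (Euc m)} (hU : IsOpen U) {ν : Euc m → Euc (n + 1)}
    {W W' : Euc m → Euc (n + 1)} (h : Set.EqOn W W' U) (i : Fin m) {x : Euc m} (hx : x ∈ U) :
    tangentD ν i W x = tangentD ν i W' x := by
  unfold tangentD
  rw [partialD_congr hU h i hx]

namespace UnitNormalOn

variable {V : Set (Euc n)} {F N : Euc n → Euc (n + 1)} {H : Euc n → Matrix (Fin n) (Fin n) ℝ}
  {U : Set (Euc m)} {u W : Euc m → Euc n} {G : Euc m → Matrix (Fin m) (Fin m) ℝ}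

theorem contDiffOn_covDeriv (h : UnitNormalOn V F N) (hH : Set.EqOn H (gramOf F) V)
    (hU : IsOpen U) (hu : ContDiffOn ℝ ∞ u U) (huV : Set.MapsTo u U V)
    (hW : ContDiffOn ℝ ∞ W U) (i : Fin m) : ContDiffOn ℝ ∞ (covDeriv H u i W) U := by
  refine contDiffOn_of_coord fun α => ?_
  change ContDiffOn ℝ ∞ (fun x => pd i (fun y => W y α) x
    + ∑ β, ∑ γ, christoffel H α β γ (u x) * pdMap u i x β * W x γ) U
  exact (BiharmonicGauss.contDiffOn_partialD hU (contDiffOn_coord hW α) i).add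
    (ContDiffOn.sum fun β _ => ContDiffOn.sum fun γ _ =>
      (((h.contDiffOn_christoffel hH α β γ).comp hu huV).mul
        (contDiffOn_coord (contDiffOn_pdMap hU hu i) β)).mul (contDiffOn_coord hW γ))

/-- Differentiate `∑ γ, W^γ (∂_γ F ∘ u)` by the product and chain rules and project: the Gauss
formula at `u x` supplies the Christoffel terms. -/
theorem fderiv_covDeriv (h : UnitNormalOn V F N) (hH : Set.EqOn H (gramOf F) V)
    (hU : IsOpen U) (hu : ContDiffOn ℝ ∞ u U) (huV : Set.MapsTo u U V)
    (hW : ContDiffOn ℝ ∞ W U) (i : Fin m) {x : Euc m} (hx : x ∈ U) :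
    fderiv ℝ F (u x) (covDeriv H u i W x) =
      tangentD (fun z => N (u z)) i (fun z => fderiv ℝ F (u z) (W z)) x := by
  have hux := differentiableAt_of_contDiffOn hU hu hx
  have hc : ∀ γ, DifferentiableAt ℝ (fun z => W z γ) x := fun γ =>
    differentiableAt_of_contDiffOn hU (contDiffOn_coord hW γ) hx
  have hd : ∀ γ, DifferentiableAt ℝ (fun z => partialD γ F (u z)) x := fun γ =>
    (h.differentiableAt_partialD γ (huV hx)).comp x hux
  have htan : ∀ γ, tproj (N (u x)) (partialD γ F (u x)) = partialD γ F (u x) := fun γ =>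
    h.tproj_fderiv (huV hx) _
  unfold tangentD
  simp only [fderiv_eq_sum_partialD]
  rw [partialD_sum _ (F := fun γ z => W z γ • partialD γ F (u z))
    fun γ _ => (hc γ).smul (hd γ), map_sum]
  have hterm : ∀ γ, tproj (N (u x)) (partialD i (fun z => W z γ • partialD γ F (u z)) x) =
      pd i (fun z => W z γ) x • partialD γ F (u x) +
        ∑ β, ∑ α, (christoffel H α β γ (u x) * pdMap u i x β * W x γ) • partialD α F (u x) := by
    intro γ
    rw [partialD_smul (hc γ) (hd γ), map_add, map_smul, map_smul, htan,
      partialD_comp (h.differentiableAt_partialD γ (huV hx)) hux, fderiv_eq_sum_partialD, map_sum,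
      Finset.smul_sum, pd_eq_partialD]
    congr 1
    refine Finset.sum_congr rfl fun β _ => ?_
    rw [map_smul, ← h.sum_christoffel_smul hH (huV hx), Finset.smul_sum, Finset.smul_sum,
      pdMap_eq_partialD hux]
    refine Finset.sum_congr rfl fun α _ => ?_
    rw [smul_smul, smul_smul]
    congr 1
    ring
  simp only [hterm, covDeriv, add_smul, Finset.sum_add_distrib, Finset.sum_smul]
  congr 1
  refine Finset.sum_comm.trans (Eq.trans ?_ Finset.sum_comm)
  exact Finset.sum_congr rfl fun β _ => Finset.sum_comm

/-- The right-hand side depends on the target only through the normal along `u` and the ambient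
field. This allows sections along the Gauss map to be compared with vector fields on the
hypersurface. -/
theorem fderiv_roughLaplacianCoord (h : UnitNormalOn V F N) (hH : Set.EqOn H (gramOf F) V)
    (hU : IsOpen U) (hu : ContDiffOn ℝ ∞ u U) (huV : Set.MapsTo u U V)
    (hW : ContDiffOn ℝ ∞ W U) {x : Euc m} (hx : x ∈ U) :
    fderiv ℝ F (u x) (roughLaplacianCoord G H u W x) =
      -tangentLaplacian G (fun z => N (u z)) (fun z => fderiv ℝ F (u z) (W z)) x := by
  unfold roughLaplacianCoord tangentLaplacian
  simp only [map_neg, map_sum, map_smul, map_sub]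
  congr 1
  refine Finset.sum_congr rfl fun i _ => Finset.sum_congr rfl fun j _ => ?_
  congr 2
  · rw [h.fderiv_covDeriv hH hU hu huV (h.contDiffOn_covDeriv hH hU hu huV hW j) i hx]
    exact tangentD_congr hU (fun z hz => h.fderiv_covDeriv hH hU hu huV hW j hz) i hx
  · exact Finset.sum_congr rfl fun k _ => by rw [h.fderiv_covDeriv hH hU hu huV hW k hx]

theorem fderiv_pdMap (h : UnitNormalOn V F N) (hU : IsOpen U) (hu : ContDiffOn ℝ ∞ u U)
    (huV : Set.MapsTo u U V) (i : Fin m) {x : Euc m} (hx : x ∈ U) :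
    fderiv ℝ F (u x) (pdMap u i x) = partialD i (fun z => F (u z)) x := by
  have hux := differentiableAt_of_contDiffOn hU hu hx
  rw [pdMap_eq_partialD hux, partialD_comp (h.differentiableAt (huV hx)) hux]

theorem fderiv_tensionCoord (h : UnitNormalOn V F N) (hH : Set.EqOn H (gramOf F) V)
    (hU : IsOpen U) (hu : ContDiffOn ℝ ∞ u U) (huV : Set.MapsTo u U V) {x : Euc m} (hx : x ∈ U) :
    fderiv ℝ F (u x) (tensionCoord G H u x) =
      ∑ i, ∑ j, (G x)⁻¹ i j •
        (tangentD (fun z => N (u z)) i (partialD j fun z => F (u z)) x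
          - ∑ k, christoffel G k i j x • partialD k (fun z => F (u z)) x) := by
  unfold tensionCoord
  simp only [map_sum, map_smul, map_sub]
  refine Finset.sum_congr rfl fun i _ => Finset.sum_congr rfl fun j _ => ?_
  congr 2
  · rw [h.fderiv_covDeriv hH hU hu huV (contDiffOn_pdMap hU hu j) i hx]
    exact tangentD_congr hU (fun z hz => h.fderiv_pdMap hU hu huV j hz) i hx
  · exact Finset.sum_congr rfl fun k _ => by rw [h.fderiv_pdMap hU hu huV k hx]

theorem contDiffOn_tensionCoord (h : UnitNormalOn V F N) (hH : Set.EqOn H (gramOf F) V)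
    (hU : IsOpen U) (hu : ContDiffOn ℝ ∞ u U) (huV : Set.MapsTo u U V)
    (hGi : ∀ i j, ContDiffOn ℝ ∞ (fun x => (G x)⁻¹ i j) U)
    (hGc : ∀ k i j, ContDiffOn ℝ ∞ (christoffel G k i j) U) :
    ContDiffOn ℝ ∞ (tensionCoord G H u) U := by
  unfold tensionCoord
  exact ContDiffOn.sum fun i _ => ContDiffOn.sum fun j _ => (hGi i j).smul
    ((h.contDiffOn_covDeriv hH hU hu huV (contDiffOn_pdMap hU hu j) i).sub
      (ContDiffOn.sum fun k _ => (hGc k i j).smul (contDiffOn_pdMap hU hu k)))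

end UnitNormalOn

end PushForward

/-! ### The Codazzi equation and the trace of the second fundamental form. -/

section SecondFundamentalForm

variable {n : ℕ}

namespace UnitNormalOn

variable {U : Set (Euc n)} {X ν : Euc n → Euc (n + 1)} {G : Euc n → Matrix (Fin n) (Fin n) ℝ}

theorem contDiffOn_partialD_normal (h : UnitNormalOn U X ν) (i : Fin n) :
    ContDiffOn ℝ ∞ (partialD i ν) U :=
  BiharmonicGauss.contDiffOn_partialD h.isOpen h.contDiffOn_normal i

theorem differentiableAt_partialD_normal (h : UnitNormalOn U X ν) (i : Fin n) {y : Euc n}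
    (hy : y ∈ U) : DifferentiableAt ℝ (partialD i ν) y :=
  differentiableAt_of_contDiffOn h.isOpen (h.contDiffOn_partialD_normal i) hy

theorem inner_normal_partialD_normal (h : UnitNormalOn U X ν) {y : Euc n} (hy : y ∈ U)
    (i : Fin n) : ⟪ν y, partialD i ν y⟫ = 0 := by
  have h1 := partialD_inner (h.differentiableAt_normal hy) (h.differentiableAt_normal hy) i
  rw [partialD_congr h.isOpen (F' := fun _ => (1 : ℝ)) (fun z hz => h.inner_normal z hz) i hy,
    partialD_const, real_inner_comm] at h1
  linarith

theorem inner_partialD_normal (h : UnitNormalOn U X ν) {y : Euc n} (hy : y ∈ U)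
    (i j : Fin n) : ⟪partialD i ν y, partialD j X y⟫ = -⟪ν y, partialD i (partialD j X) y⟫ := by
  have h1 := partialD_inner (h.differentiableAt_normal hy) (h.differentiableAt_partialD j hy) i
  rw [partialD_congr h.isOpen (F' := fun _ => (0 : ℝ)) (fun z hz => h.orthogonal z hz j) i hy,
    partialD_const] at h1
  linarith

theorem inner_partialD_normal_symm (h : UnitNormalOn U X ν) {y : Euc n} (hy : y ∈ U)
    (i j : Fin n) : ⟪partialD i ν y, partialD j X y⟫ = ⟪partialD j ν y, partialD i X y⟫ := by
  rw [h.inner_partialD_normal hy, h.inner_partialD_normal hy,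
    partialD_comm h.isOpen h.contDiffOn i j hy]

theorem christoffel_symm (h : UnitNormalOn U X ν) (hG : Set.EqOn G (gramOf X) U) {y : Euc n}
    (hy : y ∈ U) (k i j : Fin n) : christoffel G k i j y = christoffel G k j i y := by
  unfold christoffel
  congr 1
  refine Finset.sum_congr rfl fun l _ => ?_
  have : pd l (fun y => G y i j) y = pd l (fun y => G y j i) y :=
    partialD_congr h.isOpen (fun z hz => by
      simp only [hG hz, gramOf_apply]; exact real_inner_comm _ _) l hy
  rw [this]
  ring

theorem inner_partialD_partialD (h : UnitNormalOn U X ν) (hG : Set.EqOn G (gramOf X) U)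
    {y : Euc n} (hy : y ∈ U) {w : Euc (n + 1)} (hw : ⟪w, ν y⟫ = 0) (i j : Fin n) :
    ⟪w, partialD i (partialD j X) y⟫ =
      ∑ k, christoffel G k i j y * ⟪w, partialD k X y⟫ := by
  rw [← inner_tproj _ hw, ← h.sum_christoffel_smul hG hy]
  simp only [inner_sum, inner_smul_right]

/-- The pairing `⟪∂_i ν, ∂_j X⟫ = -h_ij`, minus the second fundamental form. -/
def _root_.BiharmonicGauss.weingarten (X ν : Euc n → Euc (n + 1)) (i j : Fin n) (y : Euc n) : ℝ :=
  ⟪partialD i ν y, partialD j X y⟫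

theorem contDiffOn_weingarten (h : UnitNormalOn U X ν) (i j : Fin n) :
    ContDiffOn ℝ ∞ (weingarten X ν i j) U :=
  (h.contDiffOn_partialD_normal i).inner ℝ (h.contDiffOn_partialD j)

/-- The component `∇_i` of the covariant derivative of `weingarten X ν j l`. -/
def _root_.BiharmonicGauss.codazzi (G : Euc n → Matrix (Fin n) (Fin n) ℝ)
    (X ν : Euc n → Euc (n + 1)) (i j l : Fin n) (y : Euc n) : ℝ :=
  partialD i (weingarten X ν j l) y - ∑ k, christoffel G k i l y * weingarten X ν j k y
    - ∑ k, christoffel G k i j y * weingarten X ν k l y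

theorem codazzi_symm_right (h : UnitNormalOn U X ν) {y : Euc n} (hy : y ∈ U) (i j l : Fin n) :
    codazzi G X ν i j l y = codazzi G X ν i l j y := by
  unfold codazzi
  have hs : ∀ a b, weingarten X ν a b y = weingarten X ν b a y := h.inner_partialD_normal_symm hy
  rw [partialD_congr h.isOpen (F := weingarten X ν j l) (F' := weingarten X ν l j)
    (fun z hz => h.inner_partialD_normal_symm hz j l) i hy]
  simp only [hs j, hs l]
  ring

theorem partialD_weingarten (h : UnitNormalOn U X ν) (hG : Set.EqOn G (gramOf X) U) {y : Euc n}
    (hy : y ∈ U) (i j l : Fin n) :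
    partialD i (weingarten X ν j l) y = ⟪partialD i (partialD j ν) y, partialD l X y⟫ +
      ∑ k, christoffel G k i l y * weingarten X ν j k y := by
  have h1 := partialD_inner (h.differentiableAt_partialD_normal j hy)
    (h.differentiableAt_partialD l hy) i
  have hw : ⟪partialD j ν y, ν y⟫ = 0 := by
    rw [real_inner_comm]; exact h.inner_normal_partialD_normal hy j
  rw [h.inner_partialD_partialD hG hy hw] at h1
  exact h1

/-- The derivative falling on `∂_l X` meets the tangent vector `∂_j ν`, so the Gauss formula makes
it cancel the sum with `Γ^k_il`. What remains is the tangential second derivative of `ν`. -/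
theorem codazzi_eq_inner (h : UnitNormalOn U X ν) (hG : Set.EqOn G (gramOf X) U) {y : Euc n}
    (hy : y ∈ U) (i j l : Fin n) :
    codazzi G X ν i j l y = ⟪partialD l X y, tangentD ν i (partialD j ν) y
      - ∑ k, christoffel G k i j y • partialD k ν y⟫ := by
  have hl : ⟪partialD l X y, ν y⟫ = 0 := by rw [real_inner_comm]; exact h.orthogonal y hy l
  unfold codazzi tangentD
  rw [h.partialD_weingarten hG hy, inner_sub_right, inner_tproj _ hl]
  simp only [inner_sum, inner_smul_right, real_inner_comm (partialD _ ν y),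
    real_inner_comm (partialD i (partialD j ν) y), weingarten]
  ring

/-- Codazzi equation; flatness of the ambient space is used as the commutation of second partials of
`ν`. -/
theorem codazzi_symm_left (h : UnitNormalOn U X ν) (hG : Set.EqOn G (gramOf X) U) {y : Euc n}
    (hy : y ∈ U) (i j l : Fin n) : codazzi G X ν i j l y = codazzi G X ν j i l y := by
  rw [h.codazzi_eq_inner hG hy, h.codazzi_eq_inner hG hy]
  unfold tangentD
  rw [partialD_comm h.isOpen h.contDiffOn_normal i j hy]
  simp only [h.christoffel_symm hG hy _ i j]

theorem partialD_metric (h : UnitNormalOn U X ν) (hG : Set.EqOn G (gramOf X) U) {y : Euc n}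
    (hy : y ∈ U) (l a b : Fin n) :
    partialD l (fun z => G z a b) y =
      ∑ k, christoffel G k l a y * G y k b + ∑ k, christoffel G k l b y * G y a k := by
  have ho : ∀ c, ⟪partialD c X y, ν y⟫ = 0 := fun c => by
    rw [real_inner_comm]; exact h.orthogonal y hy c
  rw [partialD_congr h.isOpen (F' := fun z => gramOf X z a b) (fun z hz => by rw [hG hz]) l hy,
    h.partialD_gramOf hy, h.inner_partialD_partialD hG hy (ho a),
    real_inner_comm (partialD b X y), h.inner_partialD_partialD hG hy (ho b), hG hy]
  congr 1
  exact Finset.sum_congr rfl fun k _ => by rw [gramOf_apply, real_inner_comm]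

theorem contDiffOn_metric_inv (h : UnitNormalOn U X ν) (hG : Set.EqOn G (gramOf X) U)
    (i j : Fin n) : ContDiffOn ℝ ∞ (fun y => (G y)⁻¹ i j) U :=
  contDiffOn_matrix_inv (h.contDiffOn_metric hG)
    (fun y hy => by rw [hG hy]; exact h.det_gramOf_ne_zero hy) i j

/-- The inverse metric is parallel. With `C` the matrix of Christoffel symbols, metric compatibility
reads `∂G = Cᵀ G + G C`, and differentiating `G G⁻¹ = 1` gives `∂(G⁻¹) = -G⁻¹ (∂G) G⁻¹`. -/
theorem partialD_metric_inv (h : UnitNormalOn U X ν) (hG : Set.EqOn G (gramOf X) U) {y : Euc n}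
    (hy : y ∈ U) (l i j : Fin n) :
    partialD l (fun z => (G z)⁻¹ i j) y =
      -(∑ a, (G y)⁻¹ i a * christoffel G j l a y + ∑ a, christoffel G i l a y * (G y)⁻¹ a j) := by
  have hdet : ∀ z ∈ U, IsUnit (G z).det := fun z hz => by
    rw [hG hz]; exact (h.det_gramOf_ne_zero hz).isUnit
  have hdG : ∀ a b, DifferentiableAt ℝ (fun z => G z a b) y := fun a b =>
    differentiableAt_of_contDiffOn h.isOpen (h.contDiffOn_metric hG a b) hy
  have hdI : ∀ a b, DifferentiableAt ℝ (fun z => (G z)⁻¹ a b) y := fun a b =>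
    differentiableAt_of_contDiffOn h.isOpen (h.contDiffOn_metric_inv hG a b) hy
  let Q : Matrix (Fin n) (Fin n) ℝ := Matrix.of fun a b => partialD l (fun z => G z a b) y
  let P : Matrix (Fin n) (Fin n) ℝ := Matrix.of fun a b => partialD l (fun z => (G z)⁻¹ a b) y
  let C : Matrix (Fin n) (Fin n) ℝ := Matrix.of fun k a => christoffel G k l a y
  have hQ : Q = C.transpose * G y + G y * C := by
    ext a b
    simp only [Q, C, Matrix.of_apply, h.partialD_metric hG hy, Matrix.add_apply, Matrix.mul_apply,
      Matrix.transpose_apply]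
    congr 1
    exact Finset.sum_congr rfl fun k _ => mul_comm _ _
  have hQP : Q * (G y)⁻¹ + G y * P = 0 := by
    ext a b
    have h1 : partialD l (fun z => ∑ c, G z a c * (G z)⁻¹ c b) y = 0 := by
      rw [partialD_congr h.isOpen (F' := fun _ => (1 : Matrix (Fin n) (Fin n) ℝ) a b)
        (fun z hz => ?_) l hy, partialD_const]
      rw [← Matrix.mul_nonsing_inv (G z) (hdet z hz)]
      rfl
    rw [partialD_sum _ (F := fun c z => G z a c * (G z)⁻¹ c b)
      fun c _ => (hdG a c).mul (hdI c b)] at h1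
    simp only [partialD_mul (hdG _ _) (hdI _ _), Finset.sum_add_distrib] at h1
    exact h1
  have hP : P = -((G y)⁻¹ * C.transpose + C * (G y)⁻¹) := by
    have h1 : G y * P = -(Q * (G y)⁻¹) := by rw [eq_neg_iff_add_eq_zero, add_comm]; exact hQP
    have h2 : P = (G y)⁻¹ * (G y * P) := by
      rw [← Matrix.mul_assoc, Matrix.nonsing_inv_mul _ (hdet y hy), Matrix.one_mul]
    have h3 : (G y)⁻¹ * (G y * C * (G y)⁻¹) = C * (G y)⁻¹ := by
      rw [← Matrix.mul_assoc, ← Matrix.mul_assoc, Matrix.nonsing_inv_mul _ (hdet y hy),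
        Matrix.one_mul]
    rw [h2, h1, hQ, Matrix.add_mul, Matrix.mul_assoc C.transpose,
      Matrix.mul_nonsing_inv _ (hdet y hy), Matrix.mul_one, Matrix.mul_neg, Matrix.mul_add, h3]
  have := congrFun (congrFun hP i) j
  simpa [P, C, Matrix.mul_apply, Matrix.of_apply] using this

/-- The trace of the derivative of the normal field, `-m` times the mean curvature. -/
def _root_.BiharmonicGauss.weingartenTrace (G : Euc n → Matrix (Fin n) (Fin n) ℝ)
    (X ν : Euc n → Euc (n + 1)) (y : Euc n) : ℝ :=
  ∑ i, ∑ j, (G y)⁻¹ i j * weingarten X ν i j y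

theorem contDiffOn_weingartenTrace (h : UnitNormalOn U X ν) (hG : Set.EqOn G (gramOf X) U) :
    ContDiffOn ℝ ∞ (weingartenTrace G X ν) U :=
  ContDiffOn.sum fun i _ => ContDiffOn.sum fun j _ =>
    (h.contDiffOn_metric_inv hG i j).mul (h.contDiffOn_weingarten i j)

/-- The trace commutes with covariant differentiation because the inverse metric is parallel, and
`codazzi` is totally symmetric, so the derivative index may be placed last. -/
theorem partialD_weingartenTrace (h : UnitNormalOn U X ν) (hG : Set.EqOn G (gramOf X) U)
    {y : Euc n} (hy : y ∈ U) (l : Fin n) :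
    partialD l (weingartenTrace G X ν) y = ∑ i, ∑ j, (G y)⁻¹ i j * codazzi G X ν i j l y := by
  have hdW : ∀ a b, DifferentiableAt ℝ (weingarten X ν a b) y := fun a b =>
    differentiableAt_of_contDiffOn h.isOpen (h.contDiffOn_weingarten a b) hy
  have hdI : ∀ a b, DifferentiableAt ℝ (fun z => (G z)⁻¹ a b) y := fun a b =>
    differentiableAt_of_contDiffOn h.isOpen (h.contDiffOn_metric_inv hG a b) hy
  have hcod : ∀ i j, codazzi G X ν i j l y = codazzi G X ν l i j y := fun i j => by
    rw [h.codazzi_symm_right hy, h.codazzi_symm_left hG hy]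
  simp only [hcod]
  unfold weingartenTrace
  rw [partialD_sum _ (F := fun i z => ∑ j, (G z)⁻¹ i j * weingarten X ν i j z)
    fun i _ => DifferentiableAt.fun_sum fun j _ => (hdI i j).mul (hdW i j)]
  have h1 : ∀ i, partialD l (fun z => ∑ j, (G z)⁻¹ i j * weingarten X ν i j z) y =
      ∑ j, (partialD l (fun z => (G z)⁻¹ i j) y * weingarten X ν i j y
        + (G y)⁻¹ i j * partialD l (weingarten X ν i j) y) := fun i => by
    rw [partialD_sum _ (F := fun j z => (G z)⁻¹ i j * weingarten X ν i j z)
      fun j _ => (hdI i j).mul (hdW i j)]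
    exact Finset.sum_congr rfl fun j _ => partialD_mul (hdI i j) (hdW i j) l
  simp only [h1, codazzi, h.partialD_metric_inv hG hy, mul_sub, Finset.sum_add_distrib,
    Finset.sum_sub_distrib, neg_mul, add_mul, Finset.sum_neg_distrib, Finset.sum_mul,
    Finset.mul_sum]
  -- `e1` and `e2` rename summation indices so that the Christoffel terms from the inverse metric
  -- cancel those inside `codazzi`.
  have e1 : ∑ i, ∑ j, ∑ a, (G y)⁻¹ i a * christoffel G j l a y * weingarten X ν i j y =
      ∑ i, ∑ j, ∑ k, (G y)⁻¹ i j * (christoffel G k l j y * weingarten X ν i k y) := by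
    refine Finset.sum_congr rfl fun i _ => Finset.sum_comm.trans ?_
    simp only [mul_assoc]
  have e2 : ∑ i, ∑ j, ∑ a, christoffel G i l a y * (G y)⁻¹ a j * weingarten X ν i j y =
      ∑ i, ∑ j, ∑ k, (G y)⁻¹ i j * (christoffel G k l i y * weingarten X ν k j y) := by
    rw [Finset.sum_comm]
    refine Eq.trans ?_ Finset.sum_comm
    refine Finset.sum_congr rfl fun j _ => Finset.sum_comm.trans ?_
    refine Finset.sum_congr rfl fun a _ => Finset.sum_congr rfl fun i _ => ?_
    ring
  rw [e1, e2]
  ring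

/-- The vector paired with `∂_l X` is the tension field of the Gauss map, seen in the ambient space.
-/
theorem inner_trace_tangentD_partialD_normal (h : UnitNormalOn U X ν)
    (hG : Set.EqOn G (gramOf X) U) {y : Euc n} (hy : y ∈ U) (l : Fin n) :
    ⟪partialD l X y, ∑ i, ∑ j, (G y)⁻¹ i j • (tangentD ν i (partialD j ν) y
      - ∑ k, christoffel G k i j y • partialD k ν y)⟫ = partialD l (weingartenTrace G X ν) y := by
  rw [h.partialD_weingartenTrace hG hy]
  simp only [inner_sum, inner_smul_right, ← h.codazzi_eq_inner hG hy]

end UnitNormalOn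

end SecondFundamentalForm

/-! ### Curvature of the unit sphere. -/

section SphereCurvature

variable {n : ℕ} {V : Set (Euc n)} {Ψ : Euc n → Euc (n + 1)}
  {H : Euc n → Matrix (Fin n) (Fin n) ℝ}

namespace UnitNormalOn

/-- As `Ψ` is its own normal, `⟪∂_j ν, ∂_k Ψ⟫` is the metric itself. -/
theorem partialD_partialD_sphere (h : UnitNormalOn V Ψ Ψ) (hH : Set.EqOn H (gramOf Ψ) V)
    {y : Euc n} (hy : y ∈ V) (j k : Fin n) :
    partialD j (partialD k Ψ) y =
      ∑ a, christoffel H a j k y • partialD a Ψ y - H y j k • Ψ y := by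
  have h1 := h.inner_partialD_normal hy j k
  rw [h.sum_christoffel_smul hH hy, tproj_apply, hH hy, gramOf_apply, h1]
  simp

/-- Gauss equation: differentiate the formula for the second partials of `Ψ` once more, project, and
equate the two orders of differentiation. Projection kills the derivative of `H`, since it
multiplies the normal `Ψ`. -/
theorem sum_curvatureCoeff_smul_sphere (h : UnitNormalOn V Ψ Ψ) (hH : Set.EqOn H (gramOf Ψ) V)
    {y : Euc n} (hy : y ∈ V) (i j k : Fin n) :
    ∑ l, curvatureCoeff H l i j k y • partialD l Ψ y =
      H y j k • partialD i Ψ y - H y i k • partialD j Ψ y := by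
  have hdΓ : ∀ a b c, DifferentiableAt ℝ (christoffel H a b c) y := fun a b c =>
    differentiableAt_of_contDiffOn h.isOpen (h.contDiffOn_christoffel hH a b c) hy
  have hdH : ∀ b c, DifferentiableAt ℝ (fun z => H z b c) y := fun b c =>
    differentiableAt_of_contDiffOn h.isOpen (h.contDiffOn_metric hH b c) hy
  have htan : ∀ a, tproj (Ψ y) (partialD a Ψ y) = partialD a Ψ y := fun a => h.tproj_fderiv hy _
  have third : ∀ a b, tproj (Ψ y) (partialD a (partialD b (partialD k Ψ)) y) =
      ∑ l, partialD a (christoffel H l b k) y • partialD l Ψ y +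
        ∑ l, (∑ c, christoffel H l a c y * christoffel H c b k y) • partialD l Ψ y
        - H y b k • partialD a Ψ y := by
    intro a b
    have hd : ∀ c, DifferentiableAt ℝ (fun z => christoffel H c b k z • partialD c Ψ z) y :=
      fun c => (hdΓ c b k).smul (h.differentiableAt_partialD c hy)
    rw [partialD_congr h.isOpen (F' := fun z => ∑ c, christoffel H c b k z • partialD c Ψ z
        - H z b k • Ψ z) (fun z hz => h.partialD_partialD_sphere hH hz b k) a hy,
      partialD_sub (F := fun z => ∑ c, christoffel H c b k z • partialD c Ψ z)
        (F' := fun z => H z b k • Ψ z) (DifferentiableAt.fun_sum fun c _ => hd c)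
        ((hdH b k).smul (h.differentiableAt hy)),
      partialD_sum _ (F := fun c z => christoffel H c b k z • partialD c Ψ z) fun c _ => hd c,
      partialD_smul (hdH b k) (h.differentiableAt hy)]
    simp only [partialD_smul (hdΓ _ b k) (h.differentiableAt_partialD _ hy), map_sub, map_add,
      map_sum, map_smul, tproj_self (h.inner_normal y hy), htan, smul_zero, zero_add,
      Finset.sum_add_distrib, ← h.sum_christoffel_smul hH hy, Finset.smul_sum, Finset.sum_smul,
      smul_smul]
    congr 2
    rw [Finset.sum_comm]
    exact Finset.sum_congr rfl fun l _ => Finset.sum_congr rfl fun c _ => by rw [mul_comm]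
  have hcomm := congrArg (tproj (Ψ y))
    (partialD_comm h.isOpen (h.contDiffOn_partialD k) i j hy)
  rw [third i j, third j i] at hcomm
  simp only [curvatureCoeff, pd_eq_partialD, add_smul, sub_smul, Finset.sum_add_distrib,
    Finset.sum_sub_distrib]
  rw [← sub_eq_zero] at hcomm ⊢
  rw [← hcomm]
  abel

theorem fderiv_curvatureOp_sphere (h : UnitNormalOn V Ψ Ψ) (hH : Set.EqOn H (gramOf Ψ) V)
    {y : Euc n} (hy : y ∈ V) (A B C : Euc n) :
    fderiv ℝ Ψ y (curvatureOp H y A B C) =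
      ⟪fderiv ℝ Ψ y B, fderiv ℝ Ψ y C⟫ • fderiv ℝ Ψ y A
        - ⟪fderiv ℝ Ψ y A, fderiv ℝ Ψ y C⟫ • fderiv ℝ Ψ y B := by
  have h1 : fderiv ℝ Ψ y (curvatureOp H y A B C) =
      ∑ i, ∑ j, ∑ k, (A i * B j * C k) • ∑ l, curvatureCoeff H l i j k y • partialD l Ψ y := by
    rw [fderiv_eq_sum_partialD]
    simp only [curvatureOp, Finset.sum_smul, Finset.smul_sum, smul_smul]
    rw [Finset.sum_comm]
    refine Finset.sum_congr rfl fun i _ => ?_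
    rw [Finset.sum_comm]
    refine Finset.sum_congr rfl fun j _ => ?_
    rw [Finset.sum_comm]
    refine Finset.sum_congr rfl fun k _ => Finset.sum_congr rfl fun l _ => ?_
    congr 1
    ring
  have h2 : ∀ P Q : Euc n, ⟪fderiv ℝ Ψ y P, fderiv ℝ Ψ y Q⟫ = ∑ i, ∑ j, P i * Q j * H y i j := by
    intro P Q
    rw [fderiv_eq_sum_partialD Ψ y P, fderiv_eq_sum_partialD Ψ y Q]
    rw [sum_inner]
    refine Finset.sum_congr rfl fun i _ => ?_
    rw [inner_sum]
    refine Finset.sum_congr rfl fun j _ => ?_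
    rw [real_inner_smul_left, real_inner_smul_right, hH hy, gramOf_apply, mul_assoc]
  rw [h1]
  simp only [h.sum_curvatureCoeff_smul_sphere hH hy, smul_sub, Finset.sum_sub_distrib, smul_smul]
  rw [h2, h2, fderiv_eq_sum_partialD Ψ y A, fderiv_eq_sum_partialD Ψ y B]
  simp only [Finset.smul_sum, smul_smul]
  congr 1
  · refine Finset.sum_congr rfl fun i _ => ?_
    simp only [← Finset.sum_smul, Finset.sum_mul]
    congr 1
    exact Finset.sum_congr rfl fun j _ => Finset.sum_congr rfl fun k _ => by ring
  · refine Finset.sum_comm.trans (Finset.sum_congr rfl fun j _ => ?_)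
    simp only [← Finset.sum_smul, Finset.sum_mul]
    congr 1
    exact Finset.sum_congr rfl fun i _ => Finset.sum_congr rfl fun k _ => by ring

end UnitNormalOn

end SphereCurvature

/-! ### Tension and bitension of the Gauss map in coordinates. -/

section GaussMapInCoordinates

variable {m n : ℕ}

theorem partialD_const_smul {E : Type*} [NormedAddCommGroup E] [NormedSpace ℝ E] (c : ℝ)
    {F : Euc m → E} {x : Euc m} (hF : DifferentiableAt ℝ F x) (i : Fin m) :
    partialD i (fun z => c • F z) x = c • partialD i F x := by
  rw [partialD_smul (differentiableAt_const c) hF, partialD_const, zero_smul, zero_add]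

theorem tangentLaplacian_of_eqOn_smul {U : Set (Euc m)} (hU : IsOpen U)
    {G : Euc m → Matrix (Fin m) (Fin m) ℝ} {ν W W' : Euc m → Euc (n + 1)}
    (hν : ContDiffOn ℝ ∞ ν U) (hW' : ContDiffOn ℝ ∞ W' U) {c : ℝ}
    (h : ∀ z ∈ U, W z = c • W' z) {x : Euc m} (hx : x ∈ U) :
    tangentLaplacian G ν W x = c • tangentLaplacian G ν W' x := by
  have hsm : ∀ j, ContDiffOn ℝ ∞ (tangentD ν j W') U := fun j =>
    (contDiffOn_partialD hU hW' j).sub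
      ((hν.inner ℝ (contDiffOn_partialD hU hW' j)).smul hν)
  have hD : ∀ j, ∀ z ∈ U, tangentD ν j W z = c • tangentD ν j W' z := fun j z hz => by
    unfold tangentD
    rw [partialD_congr hU h j hz,
      partialD_const_smul c (differentiableAt_of_contDiffOn hU hW' hz), map_smul]
  have hDD : ∀ i j, tangentD ν i (tangentD ν j W) x = c • tangentD ν i (tangentD ν j W') x :=
    fun i j => by
      rw [tangentD_congr hU (hD j) i hx]
      change tproj (ν x) (partialD i (fun z => c • tangentD ν j W' z) x) = _
      rw [partialD_const_smul c (differentiableAt_of_contDiffOn hU (hsm j) hx), map_smul]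
      rfl
  unfold tangentLaplacian
  simp only [hDD, hD _ x hx, Finset.smul_sum, smul_sub, smul_comm _ c]

namespace UnitNormalOn

variable {U V : Set (Euc n)} {X Ψ : Euc n → Euc (n + 1)} {G H : Euc n → Matrix (Fin n) (Fin n) ℝ}
  {u W : Euc n → Euc n}

/-- Smoothness of the gradient field comes from its defining pairings: `W^k = ∑ l, g^kl θ_l`. -/
theorem contDiffOn_of_inner_partialD {ν : Euc n → Euc (n + 1)} (h : UnitNormalOn U X ν)
    {θ : Fin n → Euc n → ℝ}
    (hθ : ∀ l, ContDiffOn ℝ ∞ (θ l) U)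
    (hW : ∀ z ∈ U, ∀ l, ⟪partialD l X z, fderiv ℝ X z (W z)⟫ = θ l z) :
    ContDiffOn ℝ ∞ W U := by
  have hG : Set.EqOn (gramOf X) (gramOf X) U := Set.eqOn_refl _ _
  have key : ∀ z ∈ U, W z = WithLp.toLp 2 fun k => ∑ l, (gramOf X z)⁻¹ k l * θ l z := by
    intro z hz
    apply h.injective z hz
    rw [eq_sum_gram_inv (h.linearIndependent hz) (h.mem_span hz (h.inner_normal_fderiv hz (W z)))]
    simp only [hW z hz]
    rw [fderiv_eq_sum_partialD]
    simp only [Finset.sum_smul]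
    rfl
  refine ContDiffOn.congr (contDiffOn_of_coord fun k => ?_) key
  change ContDiffOn ℝ ∞ (fun z => ∑ l, (gramOf X z)⁻¹ k l * θ l z) U
  exact ContDiffOn.sum fun l _ => (h.contDiffOn_metric_inv hG k l).mul (hθ l)

/-- `hX` says that `Ψ ∘ u` is the normal of `X`, that is, `u` is the Gauss map; `hW` says that `W`
is the gradient of the mean curvature. Both sides are then tangent to `X`, so testing against each
`∂_l X` suffices. -/
theorem fderiv_tensionCoord_gaussMap (hX : UnitNormalOn U X fun z => Ψ (u z))
    (hG : Set.EqOn G (gramOf X) U) (hΨ : UnitNormalOn V Ψ Ψ) (hH : Set.EqOn H (gramOf Ψ) V)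
    (hu : ContDiffOn ℝ ∞ u U) (huV : Set.MapsTo u U V) (hn : n ≠ 0)
    (hW : ∀ z ∈ U, ∀ l, ⟪partialD l X z, fderiv ℝ X z (W z)⟫ =
      -(1 / (n : ℝ)) * partialD l (weingartenTrace G X fun z => Ψ (u z)) z)
    {x : Euc n} (hx : x ∈ U) :
    fderiv ℝ Ψ (u x) (tensionCoord G H u x) = -(n : ℝ) • fderiv ℝ X x (W x) := by
  refine eq_of_inner_basis_eq (v := fun i => partialD i X x)
    (hX.mem_span hx (hΨ.inner_normal_fderiv (huV hx) _))
    (Submodule.smul_mem _ _ (hX.mem_span hx (hX.inner_normal_fderiv hx _))) fun l => ?_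
  rw [hΨ.fderiv_tensionCoord hH hX.isOpen hu huV hx,
    hX.inner_trace_tangentD_partialD_normal hG hx, inner_smul_right, hW x hx]
  field_simp

theorem fderiv_bitensionCoord_gaussMap (hX : UnitNormalOn U X fun z => Ψ (u z))
    (hG : Set.EqOn G (gramOf X) U) (hΨ : UnitNormalOn V Ψ Ψ) (hH : Set.EqOn H (gramOf Ψ) V)
    (hu : ContDiffOn ℝ ∞ u U) (huV : Set.MapsTo u U V) (hn : n ≠ 0)
    (hW : ∀ z ∈ U, ∀ l, ⟪partialD l X z, fderiv ℝ X z (W z)⟫ =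
      -(1 / (n : ℝ)) * partialD l (weingartenTrace G X fun z => Ψ (u z)) z)
    {x : Euc n} (hx : x ∈ U) :
    fderiv ℝ Ψ (u x) (bitensionCoord G H u x) =
      (n : ℝ) • (fderiv ℝ X x (roughLaplacianCoord G G id W x)
        + ∑ i, ∑ j, (G x)⁻¹ i j •
          (⟪fderiv ℝ X x (W x), partialD j (fun z => Ψ (u z)) x⟫ • partialD i (fun z => Ψ (u z)) x
            - ⟪partialD i (fun z => Ψ (u z)) x, partialD j (fun z => Ψ (u z)) x⟫ •
              fderiv ℝ X x (W x))) := by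
  have hWsm : ContDiffOn ℝ ∞ W U := hX.contDiffOn_of_inner_partialD
    (fun l => contDiffOn_const.mul
      (BiharmonicGauss.contDiffOn_partialD hX.isOpen (hX.contDiffOn_weingartenTrace hG) l)) hW
  have hτ : ∀ z ∈ U, fderiv ℝ Ψ (u z) (tensionCoord G H u z) = -(n : ℝ) • fderiv ℝ X z (W z) :=
    fun z hz => hX.fderiv_tensionCoord_gaussMap hG hΨ hH hu huV hn hW hz
  have hτsm : ContDiffOn ℝ ∞ (tensionCoord G H u) U :=
    hΨ.contDiffOn_tensionCoord hH hX.isOpen hu huV (hX.contDiffOn_metric_inv hG)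
      (hX.contDiffOn_christoffel hG)
  have hXW : ContDiffOn ℝ ∞ (fun z => fderiv ℝ X z (W z)) U :=
    (hX.contDiffOn.fderiv_of_isOpen hX.isOpen (by simp)).clm_apply hWsm
  have h1 := hΨ.fderiv_roughLaplacianCoord (G := G) hH hX.isOpen hu huV hτsm hx
  rw [tangentLaplacian_of_eqOn_smul hX.isOpen hX.contDiffOn_normal hXW hτ hx] at h1
  -- Vector fields on the hypersurface are sections along `id`. The resulting tangential Laplacian
  -- has the same normal `Ψ ∘ u` as the one in `h1`.
  have h2 := hX.fderiv_roughLaplacianCoord (G := G) hG hX.isOpen contDiffOn_id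
    (Set.mapsTo_id U) hWsm hx
  simp only [id] at h2
  unfold bitensionCoord
  simp only [map_sub, map_neg, map_sum, map_smul,
    hΨ.fderiv_curvatureOp_sphere hH (huV hx), hΨ.fderiv_pdMap hX.isOpen hu huV _ hx, hτ x hx, h1]
  rw [h2, smul_add, sub_eq_add_neg]
  congr 1
  · module
  · rw [Finset.smul_sum, ← Finset.sum_neg_distrib]
    refine Finset.sum_congr rfl fun i _ => ?_
    rw [Finset.smul_sum, ← Finset.sum_neg_distrib]
    refine Finset.sum_congr rfl fun j _ => ?_
    rw [real_inner_smul_left]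
    module

end UnitNormalOn

end GaussMapInCoordinates

/-! ### Passage between the manifold and its preferred charts. -/

section Charts

variable {m : ℕ} {M : Type*} [TopologicalSpace M] [ChartedSpace (Euc m) M] [IsManifold (𝓡 m) ∞ M]
  {E : Type*} [NormedAddCommGroup E] [NormedSpace ℝ E]

/-- The expression of a vector-valued function in the preferred chart at `p`. -/
def inChart (F : M → E) (p : M) (y : Euc m) : E := F ((extChartAt (𝓡 m) p).symm y)

theorem mdifferentiableAt_extChartAt_symm {p : M} {y : Euc m}
    (hy : y ∈ (extChartAt (𝓡 m) p).target) :
    MDifferentiableAt 𝓘(ℝ, Euc m) (𝓡 m) (extChartAt (𝓡 m) p).symm y := by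
  have := mdifferentiableWithinAt_extChartAt_symm (I := 𝓡 m) hy
  rwa [ModelWithCorners.range_eq_univ, mdifferentiableWithinAt_univ] at this

theorem fderiv_inChart {F : M → E} {p : M} {y : Euc m} (hy : y ∈ (extChartAt (𝓡 m) p).target)
    (hF : MDifferentiableAt (𝓡 m) 𝓘(ℝ, E) F ((extChartAt (𝓡 m) p).symm y)) (v : Euc m) :
    fderiv ℝ (inChart F p) y v = mvfderiv (𝓡 m) F ((extChartAt (𝓡 m) p).symm y)
      (mfderiv 𝓘(ℝ, Euc m) (𝓡 m) (extChartAt (𝓡 m) p).symm y v) := by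
  have h := mfderiv_comp_apply y hF (mdifferentiableAt_extChartAt_symm hy) v
  rw [mfderiv_eq_fderiv] at h
  exact h

theorem mfderiv_symm_mvfderiv_extChartAt {p : M} {y : Euc m}
    (hy : y ∈ (extChartAt (𝓡 m) p).target)
    (w : TangentSpace (𝓡 m) ((extChartAt (𝓡 m) p).symm y)) :
    mfderiv 𝓘(ℝ, Euc m) (𝓡 m) (extChartAt (𝓡 m) p).symm y
      (mvfderiv (𝓡 m) (extChartAt (𝓡 m) p) ((extChartAt (𝓡 m) p).symm y) w) = w := by
  have h := mfderivWithin_extChartAt_symm_comp_mfderiv_extChartAt (I := 𝓡 m) hy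
  rw [ModelWithCorners.range_eq_univ, mfderivWithin_univ] at h
  exact congrFun (congrArg DFunLike.coe h) w

theorem mvfderiv_extChartAt_mfderiv_symm {p : M} {y : Euc m}
    (hy : y ∈ (extChartAt (𝓡 m) p).target) (v : Euc m) :
    mvfderiv (𝓡 m) (extChartAt (𝓡 m) p) ((extChartAt (𝓡 m) p).symm y)
      (mfderiv 𝓘(ℝ, Euc m) (𝓡 m) (extChartAt (𝓡 m) p).symm y v) = v := by
  have h := mfderiv_extChartAt_comp_mfderivWithin_extChartAt_symm (I := 𝓡 m) hy
  rw [ModelWithCorners.range_eq_univ, mfderivWithin_univ] at h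
  exact congrFun (congrArg DFunLike.coe h) v

/-- The coordinate basis of the tangent space at a point of the domain of the preferred chart
at `p`. -/
def chartBasis (p : M) {y : Euc m} (hy : y ∈ (extChartAt (𝓡 m) p).target) :
    Module.Basis (Fin m) ℝ (TangentSpace (𝓡 m) ((extChartAt (𝓡 m) p).symm y)) :=
  (EuclideanSpace.basisFun (Fin m) ℝ).toBasis.map
    { toFun := fun v : Euc m => mfderiv 𝓘(ℝ, Euc m) (𝓡 m) (extChartAt (𝓡 m) p).symm y v
      invFun := fun w => mvfderiv (𝓡 m) (extChartAt (𝓡 m) p) ((extChartAt (𝓡 m) p).symm y) w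
      map_add' := fun v w => map_add (mfderiv 𝓘(ℝ, Euc m) (𝓡 m) (extChartAt (𝓡 m) p).symm y) v w
      map_smul' := fun c v =>
        map_smul (mfderiv 𝓘(ℝ, Euc m) (𝓡 m) (extChartAt (𝓡 m) p).symm y) c v
      left_inv := mvfderiv_extChartAt_mfderiv_symm hy
      right_inv := mfderiv_symm_mvfderiv_extChartAt hy }

theorem chartBasis_apply (p : M) {y : Euc m} (hy : y ∈ (extChartAt (𝓡 m) p).target) (i : Fin m) :
    chartBasis p hy i = mfderiv 𝓘(ℝ, Euc m) (𝓡 m) (extChartAt (𝓡 m) p).symm y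
      (EuclideanSpace.single i (1 : ℝ)) := by
  unfold chartBasis
  rw [Module.Basis.map_apply, OrthonormalBasis.coe_toBasis, EuclideanSpace.basisFun_apply]
  rfl

theorem partialD_inChart {F : M → E} {p : M} {y : Euc m}
    (hy : y ∈ (extChartAt (𝓡 m) p).target)
    (hF : MDifferentiableAt (𝓡 m) 𝓘(ℝ, E) F ((extChartAt (𝓡 m) p).symm y)) (i : Fin m) :
    partialD i (inChart F p) y =
      mvfderiv (𝓡 m) F ((extChartAt (𝓡 m) p).symm y) (chartBasis p hy i) := by
  rw [chartBasis_apply]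
  exact fderiv_inChart hy hF _

theorem fderiv_inChart_fieldInChart {F : M → E} {p : M} {y : Euc m}
    (hy : y ∈ (extChartAt (𝓡 m) p).target)
    (hF : MDifferentiableAt (𝓡 m) 𝓘(ℝ, E) F ((extChartAt (𝓡 m) p).symm y))
    (V : TangentField m M) :
    fderiv ℝ (inChart F p) y (fieldInChart V p y) =
      mvfderiv (𝓡 m) F ((extChartAt (𝓡 m) p).symm y) (V ((extChartAt (𝓡 m) p).symm y)) := by
  rw [fderiv_inChart hy hF]
  unfold fieldInChart
  rw [mfderiv_symm_mvfderiv_extChartAt hy]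

theorem contDiffOn_inChart {F : M → E} (hF : ContMDiff (𝓡 m) 𝓘(ℝ, E) ∞ F) (p : M) :
    ContDiffOn ℝ ∞ (inChart F p) (extChartAt (𝓡 m) p).target :=
  contMDiffOn_iff_contDiffOn.1
    (hF.comp_contMDiffOn (contMDiffOn_extChartAt_symm (I := 𝓡 m) (n := ∞) p))

/-- A tangent vector at `p` is by convention its coordinate vector in the chart at `p`, so the
inverse chart has identity derivative there. -/
theorem fderiv_inChart_self {F : M → E} {p : M}
    (hF : MDifferentiableAt (𝓡 m) 𝓘(ℝ, E) F p) (v : Euc m) :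
    fderiv ℝ (inChart F p) (extChartAt (𝓡 m) p p) v = mvfderiv (𝓡 m) F p v := by
  have hid := mfderivWithin_range_extChartAt_symm (I := 𝓡 m) (x := p)
  rw [ModelWithCorners.range_eq_univ, mfderivWithin_univ] at hid
  have hp := extChartAt_to_inv (I := 𝓡 m) p
  have h := mfderiv_comp_apply_of_eq (extChartAt (𝓡 m) p p) hF
    (mdifferentiableAt_extChartAt_symm (mem_extChartAt_target p)) hp v
  rw [mfderiv_eq_fderiv, hid] at h
  exact h

theorem partialD_inChart_self {F : M → E} {p : M}
    (hF : MDifferentiableAt (𝓡 m) 𝓘(ℝ, E) F p) (i : Fin m) :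
    partialD i (inChart F p) (extChartAt (𝓡 m) p p) = mvfderiv (𝓡 m) F p (basisVec p i) :=
  fderiv_inChart_self hF _

/-- Meant for the mean curvature, whose regularity is known only through its coordinate formula. -/
theorem mdifferentiableAt_of_inChart {F : M → E} {p : M} {y : Euc m}
    (hy : y ∈ (extChartAt (𝓡 m) p).target) (hF : DifferentiableAt ℝ (inChart F p) y) :
    MDifferentiableAt (𝓡 m) 𝓘(ℝ, E) F ((extChartAt (𝓡 m) p).symm y) := by
  have hs : (extChartAt (𝓡 m) p).symm y ∈ (extChartAt (𝓡 m) p).source :=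
    (extChartAt (𝓡 m) p).map_target hy
  have hc : MDifferentiableAt (𝓡 m) 𝓘(ℝ, Euc m) (extChartAt (𝓡 m) p)
      ((extChartAt (𝓡 m) p).symm y) :=
    mdifferentiableAt_extChartAt (by rwa [extChartAt_source] at hs)
  have hF' : DifferentiableAt ℝ (inChart F p)
      (extChartAt (𝓡 m) p ((extChartAt (𝓡 m) p).symm y)) := by
    rwa [(extChartAt (𝓡 m) p).right_inv hy]
  refine (hF'.mdifferentiableAt.comp _ hc).congr_of_eventuallyEq ?_
  filter_upwards [(isOpen_extChartAt_source (I := 𝓡 m) p).mem_nhds hs] with q hq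
  simp only [Function.comp, inChart, (extChartAt (𝓡 m) p).left_inv hq]

end Charts

/-! ### The induced metric in the preferred basis. -/

section Hypersurface

variable {m : ℕ} {M : Type*} [TopologicalSpace M] [ChartedSpace (Euc m) M]

theorem gramAt_inducedMetric (F : M → Euc (m + 1)) (p : M) :
    gramAt (inducedMetric (m := m) F) p =
      Matrix.gram ℝ fun i => mvfderiv (𝓡 m) F p (basisVec p i) := rfl

theorem linearIndependent_mvfderiv_basisVec {F : M → Euc (m + 1)} {p : M}
    (hF : Function.Injective (mvfderiv (𝓡 m) F p)) :
    LinearIndependent ℝ fun i => mvfderiv (𝓡 m) F p (basisVec p i) :=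
  linearIndependent_apply_single (mvfderiv (𝓡 m) F p) hF

theorem eq_sum_basisVec (p : M) (v : TangentSpace (𝓡 m) p) :
    v = ∑ i, (show Euc m from v) i • basisVec p i := by
  change (show Euc m from v) =
    ∑ i, (show Euc m from v) i • (EuclideanSpace.single i (1 : ℝ) : Euc m)
  conv_lhs => rw [← (EuclideanSpace.basisFun (Fin m) ℝ).sum_repr v]
  simp only [EuclideanSpace.basisFun_apply]
  rfl

theorem inner_mvfderiv_sharp {F : M → Euc (m + 1)} {p : M}
    (hF : Function.Injective (mvfderiv (𝓡 m) F p)) (θ : TangentSpace (𝓡 m) p →ₗ[ℝ] ℝ)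
    (v : TangentSpace (𝓡 m) p) :
    ⟪mvfderiv (𝓡 m) F p v, mvfderiv (𝓡 m) F p (sharp (inducedMetric F) p θ)⟫ = θ v := by
  have hb : ∀ i, ⟪mvfderiv (𝓡 m) F p (basisVec p i),
      mvfderiv (𝓡 m) F p (sharp (inducedMetric F) p θ)⟫ = θ (basisVec p i) := fun i => by
    rw [← inner_sum_gram_inv (linearIndependent_mvfderiv_basisVec hF)
      (fun j => θ (basisVec p j)) i]
    simp only [sharp, map_sum, map_smul, gramAt_inducedMetric]
  rw [eq_sum_basisVec p v]
  simp only [map_sum, map_smul, sum_inner, real_inner_smul_left, hb, smul_eq_mul]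

end Hypersurface

/-! ### Unit normal fields on manifolds, shape operator and mean curvature. -/

section GaussMap

variable {m : ℕ} {M : Type*} [TopologicalSpace M] [ChartedSpace (Euc m) M]

/-- `F` is a smooth immersion of codimension one, and `N` a smooth unit normal field of `F`. -/
structure IsUnitNormalField (F N : M → Euc (m + 1)) : Prop where
  contMDiff : ContMDiff (𝓡 m) 𝓘(ℝ, Euc (m + 1)) ∞ F
  injective : ∀ p, Function.Injective (mvfderiv (𝓡 m) F p)
  contMDiff_normal : ContMDiff (𝓡 m) 𝓘(ℝ, Euc (m + 1)) ∞ N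
  inner_normal : ∀ p, ⟪N p, N p⟫ = 1
  orthogonal : ∀ p (v : TangentSpace (𝓡 m) p), ⟪N p, mvfderiv (𝓡 m) F p v⟫ = 0

namespace IsUnitNormalField

variable {F N : M → Euc (m + 1)}

theorem mdifferentiableAt (h : IsUnitNormalField F N) (p : M) :
    MDifferentiableAt (𝓡 m) 𝓘(ℝ, Euc (m + 1)) F p := (h.contMDiff p).mdifferentiableAt (by simp)

theorem mdifferentiableAt_normal (h : IsUnitNormalField F N) (p : M) :
    MDifferentiableAt (𝓡 m) 𝓘(ℝ, Euc (m + 1)) N p :=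
  (h.contMDiff_normal p).mdifferentiableAt (by simp)

theorem mem_span_basisVec (h : IsUnitNormalField F N) (p : M) {w : Euc (m + 1)}
    (hw : ⟪N p, w⟫ = 0) :
    w ∈ Submodule.span ℝ (Set.range fun i => mvfderiv (𝓡 m) F p (basisVec p i)) :=
  mem_span_of_inner_normal_eq_zero (linearIndependent_mvfderiv_basisVec (h.injective p))
    (h.inner_normal p) (fun _ => h.orthogonal p _) hw

theorem eq_of_inner_mvfderiv (h : IsUnitNormalField F N) (p : M) {w w' : Euc (m + 1)}
    (hw : ⟪N p, w⟫ = 0) (hw' : ⟪N p, w'⟫ = 0)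
    (hi : ∀ v, ⟪mvfderiv (𝓡 m) F p v, w⟫ = ⟪mvfderiv (𝓡 m) F p v, w'⟫) : w = w' :=
  eq_of_inner_basis_eq (h.mem_span_basisVec p hw) (h.mem_span_basisVec p hw') fun _ => hi _

variable [IsManifold (𝓡 m) ∞ M]

theorem unitNormalOn (h : IsUnitNormalField F N) (p : M) :
    UnitNormalOn (extChartAt (𝓡 m) p).target (inChart F p) (inChart N p) where
  isOpen := isOpen_extChartAt_target p
  contDiffOn := contDiffOn_inChart h.contMDiff p
  contDiffOn_normal := contDiffOn_inChart h.contMDiff_normal p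
  inner_normal y _ := h.inner_normal _
  orthogonal y hy i := by
    rw [partialD_inChart hy (h.mdifferentiableAt _)]
    exact h.orthogonal _ _
  injective y hy v w hvw := by
    rw [fderiv_inChart hy (h.mdifferentiableAt _), fderiv_inChart hy (h.mdifferentiableAt _)] at hvw
    have := h.injective _ hvw
    rw [← mvfderiv_extChartAt_mfderiv_symm hy v, this, mvfderiv_extChartAt_mfderiv_symm hy]

theorem metricInChart_eq (h : IsUnitNormalField F N) (p : M) :
    Set.EqOn (metricInChart (inducedMetric F) p) (gramOf (inChart F p))
      (extChartAt (𝓡 m) p).target := by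
  intro y hy
  ext i j
  rw [gramOf_apply, partialD_inChart hy (h.mdifferentiableAt _),
    partialD_inChart hy (h.mdifferentiableAt _), chartBasis_apply, chartBasis_apply]
  rfl

theorem gramAt_eq (h : IsUnitNormalField F N) (p : M) :
    gramAt (inducedMetric (m := m) F) p = gramOf (inChart F p) (extChartAt (𝓡 m) p p) := by
  rw [gramAt_inducedMetric]
  unfold gramOf
  simp only [partialD_inChart_self (h.mdifferentiableAt p)]

theorem inner_normal_mvfderiv_normal (h : IsUnitNormalField F N) (p : M)
    (v : TangentSpace (𝓡 m) p) : ⟪N p, mvfderiv (𝓡 m) N p v⟫ = 0 := by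
  rw [eq_sum_basisVec p v]
  simp only [map_sum, map_smul, inner_sum, real_inner_smul_right]
  refine Finset.sum_eq_zero fun i _ => ?_
  have := (h.unitNormalOn p).inner_normal_partialD_normal (mem_extChartAt_target p) i
  rw [partialD_inChart_self (h.mdifferentiableAt_normal p)] at this
  unfold inChart at this
  rw [extChartAt_to_inv] at this
  rw [this, mul_zero]

end IsUnitNormalField

theorem isUnitNormalField_sphere (m : ℕ) :
    IsUnitNormalField (m := m) (fun q : UnitSphere m => (q : Euc (m + 1))) fun q => q := by
  have : Fact (Module.finrank ℝ (Euc (m + 1)) = m + 1) := ⟨finrank_euclideanSpace_fin⟩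
  refine ⟨contMDiff_coe_sphere, injective_mvfderiv_subtypeVal_sphere, contMDiff_coe_sphere,
    fun q => ?_, fun q v => ?_⟩
  · rw [real_inner_self_eq_norm_sq, norm_eq_of_mem_sphere]
    norm_num
  · have h : mvfderiv (𝓡 m) (fun q : UnitSphere m => (q : Euc (m + 1))) q v ∈
        (ℝ ∙ (q : Euc (m + 1)))ᗮ := by
      rw [← range_mvfderiv_subtypeVal (n := m) q]
      exact ⟨v, rfl⟩
    exact Submodule.mem_orthogonal_singleton_iff_inner_right.1 h

theorem isUnitNormalField_of_isGaussMap {ι : M → Euc (m + 1)} {η : M → UnitSphere m}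
    (hι : IsHypersurface ι) (hη : IsGaussMap ι η) :
    IsUnitNormalField ι fun p => (η p : Euc (m + 1)) where
  contMDiff := hι.1
  injective := hι.2
  contMDiff_normal := (isUnitNormalField_sphere m).contMDiff.comp hη.1
  inner_normal p := (isUnitNormalField_sphere m).inner_normal (η p)
  orthogonal p v := by rw [real_inner_comm]; exact hη.2 p v

section ShapeOperator

variable [IsManifold (𝓡 m) ∞ M] {ι : M → Euc (m + 1)} {η : M → UnitSphere m}

theorem mvfderiv_shapeOperator (h : IsUnitNormalField ι fun p => (η p : Euc (m + 1))) (p : M)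
    (v : TangentSpace (𝓡 m) p) :
    mvfderiv (𝓡 m) ι p (shapeOperator ι η p v) =
      -mvfderiv (𝓡 m) (fun q => (η q : Euc (m + 1))) p v := by
  refine h.eq_of_inner_mvfderiv p (h.orthogonal p _) ?_ fun w => ?_
  · rw [inner_neg_right, h.inner_normal_mvfderiv_normal, neg_zero]
  · refine (inner_mvfderiv_sharp (h.injective p) _ w).trans ?_
    rw [inner_neg_right, real_inner_comm]
    rfl

/-- Self-adjointness reduces, on basis vectors, to the symmetry of second partials of `ι`. -/
theorem inner_mvfderiv_shapeOperator_comm (h : IsUnitNormalField ι fun p => (η p : Euc (m + 1)))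
    (p : M) (v w : TangentSpace (𝓡 m) p) :
    ⟪mvfderiv (𝓡 m) ι p (shapeOperator ι η p v), mvfderiv (𝓡 m) ι p w⟫ =
      ⟪mvfderiv (𝓡 m) ι p v, mvfderiv (𝓡 m) ι p (shapeOperator ι η p w)⟫ := by
  have hb : ∀ i j, ⟪mvfderiv (𝓡 m) (fun q => (η q : Euc (m + 1))) p (basisVec p i),
      mvfderiv (𝓡 m) ι p (basisVec p j)⟫ =
      ⟪mvfderiv (𝓡 m) ι p (basisVec p i),
        mvfderiv (𝓡 m) (fun q => (η q : Euc (m + 1))) p (basisVec p j)⟫ := fun i j => by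
    have := (h.unitNormalOn p).inner_partialD_normal_symm (mem_extChartAt_target p) i j
    rw [partialD_inChart_self (h.mdifferentiableAt_normal p),
      partialD_inChart_self (h.mdifferentiableAt_normal p),
      partialD_inChart_self (h.mdifferentiableAt p),
      partialD_inChart_self (h.mdifferentiableAt p)] at this
    rw [this, real_inner_comm]
  rw [mvfderiv_shapeOperator h, mvfderiv_shapeOperator h, inner_neg_left, inner_neg_right,
    eq_sum_basisVec p v, eq_sum_basisVec p w]
  simp only [map_sum, map_smul, inner_sum, sum_inner, real_inner_smul_left, real_inner_smul_right,
    hb]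

/-- Needed on the whole chart domain, since `f` is to be differentiated. The trace does not depend
on the basis, so the coordinate basis of the fixed chart at `p` may be used at every point. -/
theorem meanCurvature_eq (h : IsUnitNormalField ι fun p => (η p : Euc (m + 1))) {p : M} {y : Euc m}
    (hy : y ∈ (extChartAt (𝓡 m) p).target) :
    inChart (meanCurvature ι η) p y = -(1 / (m : ℝ)) *
      weingartenTrace (gramOf (inChart ι p)) (inChart ι p)
        (inChart (fun q => (η q : Euc (m + 1))) p) y := by
  have hpX := fun i => partialD_inChart hy (h.mdifferentiableAt _) i
  have hpN := fun i => partialD_inChart hy (h.mdifferentiableAt_normal _) i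
  have hX := (h.unitNormalOn p).linearIndependent hy
  simp only [hpX] at hX
  have hg : gramOf (inChart ι p) y = Matrix.gram ℝ fun i => mvfderiv (𝓡 m) ι _
      (chartBasis p hy i) := by
    unfold gramOf
    simp only [hpX]
  change 1 / (m : ℝ) * LinearMap.trace ℝ _ (shapeOperator ι η _) = _
  rw [trace_eq_sum_gram_inv (chartBasis p hy) (mvfderiv (𝓡 m) ι _).toLinearMap hX,
    weingartenTrace, hg, neg_mul, ← mul_neg, ← Finset.sum_neg_distrib]
  congr 1
  refine Finset.sum_congr rfl fun i _ => ?_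
  rw [← Finset.sum_neg_distrib]
  refine Finset.sum_congr rfl fun j _ => ?_
  rw [weingarten, hpX, hpN, ← mul_neg, ← inner_neg_left, ← mvfderiv_shapeOperator h]
  rfl

theorem inner_partialD_fieldInChart_grad (h : IsUnitNormalField ι fun p => (η p : Euc (m + 1)))
    {p : M} {y : Euc m} (hy : y ∈ (extChartAt (𝓡 m) p).target) (l : Fin m) :
    ⟪partialD l (inChart ι p) y, fderiv ℝ (inChart ι p) y
      (fieldInChart (grad (inducedMetric ι) (meanCurvature ι η)) p y)⟫ =
      -(1 / (m : ℝ)) * partialD l (weingartenTrace (gramOf (inChart ι p)) (inChart ι p)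
        (inChart (fun q => (η q : Euc (m + 1))) p)) y := by
  have hU := h.unitNormalOn p
  have hd := differentiableAt_of_contDiffOn hU.isOpen
    (hU.contDiffOn_weingartenTrace (Set.eqOn_refl (gramOf (inChart ι p)) _)) hy
  have hf : DifferentiableAt ℝ (inChart (meanCurvature ι η) p) y := by
    refine (hd.const_mul (-(1 / (m : ℝ)))).congr_of_eventuallyEq ?_
    filter_upwards [hU.isOpen.mem_nhds hy] with z hz using meanCurvature_eq h hz
  rw [partialD_inChart hy (h.mdifferentiableAt _),
    fderiv_inChart_fieldInChart hy (h.mdifferentiableAt _)]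
  refine (inner_mvfderiv_sharp (h.injective _) _ _).trans ?_
  refine (partialD_inChart hy (mdifferentiableAt_of_inChart hy hf) l).symm.trans ?_
  rw [partialD_congr hU.isOpen (fun z hz => meanCurvature_eq h hz) l hy]
  exact partialD_const_smul _ hd l

end ShapeOperator

end GaussMap

/-! ### Tension and bitension fields of the Gauss map on the manifold. -/

section GaussMapTension

variable {m : ℕ} {M : Type*} [TopologicalSpace M] [ChartedSpace (Euc m) M]
  {ι : M → Euc (m + 1)} {η : M → UnitSphere m}

/-- The part of the domain of the chart at `p` that `η` maps to the domain of the chart at `η p`. -/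
def gaussDomain (η : M → UnitSphere m) (p : M) : Set (Euc m) :=
  (extChartAt (𝓡 m) p).target ∩
    (extChartAt (𝓡 m) p).symm ⁻¹' (η ⁻¹' (extChartAt (𝓡 m) (η p)).source)

theorem mem_gaussDomain (η : M → UnitSphere m) (p : M) :
    extChartAt (𝓡 m) p p ∈ gaussDomain η p := by
  refine ⟨mem_extChartAt_target p, ?_⟩
  rw [Set.mem_preimage, extChartAt_to_inv]
  exact mem_extChartAt_source (η p)

theorem isOpen_gaussDomain (hη : ContMDiff (𝓡 m) (𝓡 m) ∞ η) (p : M) :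
    IsOpen (gaussDomain η p) :=
  (continuousOn_extChartAt_symm p).isOpen_inter_preimage (isOpen_extChartAt_target p)
    ((isOpen_extChartAt_source (η p)).preimage hη.continuous)

theorem mapsTo_mapInChart (η : M → UnitSphere m) (p : M) :
    Set.MapsTo (mapInChart (m := m) (n := m) η p) (gaussDomain η p)
      (extChartAt (𝓡 m) (η p)).target :=
  fun _ hy => (extChartAt (𝓡 m) (η p)).map_source hy.2

/-- This identifies `Ψ ∘ u` of the coordinate computation with the unit normal of `ι`. -/
theorem inChart_mapInChart (η : M → UnitSphere m) (p : M) :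
    Set.EqOn
      (fun z => inChart (m := m) (fun q : UnitSphere m => (q : Euc (m + 1))) (η p)
        (mapInChart (m := m) (n := m) η p z))
      (inChart (m := m) (fun q => (η q : Euc (m + 1))) p) (gaussDomain η p) := fun y hy => by
  simp only [inChart, mapInChart, (extChartAt (𝓡 m) (η p)).left_inv hy.2]

variable [IsManifold (𝓡 m) ∞ M]

theorem contDiffOn_mapInChart (hη : ContMDiff (𝓡 m) (𝓡 m) ∞ η) (p : M) :
    ContDiffOn ℝ ∞ (mapInChart (m := m) (n := m) η p) (gaussDomain η p) := by
  have h1 : ContMDiffOn 𝓘(ℝ, Euc m) (𝓡 m) ∞ (fun y => η ((extChartAt (𝓡 m) p).symm y))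
      (gaussDomain η p) :=
    (hη.comp_contMDiffOn (contMDiffOn_extChartAt_symm (I := 𝓡 m) (n := ∞) p)).mono
      Set.inter_subset_left
  refine contMDiffOn_iff_contDiffOn.1
    ((contMDiffOn_extChartAt (I := 𝓡 m) (n := ∞) (x := η p)).comp h1 fun y hy => ?_)
  have := hy.2
  rwa [Set.mem_preimage, Set.mem_preimage, extChartAt_source] at this

theorem unitNormalOn_gaussDomain (hι : IsHypersurface ι) (hη : IsGaussMap ι η) (p : M) :
    UnitNormalOn (gaussDomain η p) (inChart ι p) fun z =>
      inChart (m := m) (fun q : UnitSphere m => (q : Euc (m + 1))) (η p)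
        (mapInChart (m := m) (n := m) η p z) :=
  ((isUnitNormalField_of_isGaussMap hι hη).unitNormalOn p).mono_congr
    (isOpen_gaussDomain hη.1 p) Set.inter_subset_left (inChart_mapInChart η p)

theorem inner_partialD_fieldInChart_grad_gaussDomain (hι : IsHypersurface ι)
    (hη : IsGaussMap ι η) (p : M) {z : Euc m} (hz : z ∈ gaussDomain η p) (l : Fin m) :
    ⟪partialD l (inChart ι p) z, fderiv ℝ (inChart ι p) z
      (fieldInChart (grad (inducedMetric (m := m) ι) (meanCurvature ι η)) p z)⟫ =
      -(1 / (m : ℝ)) * partialD l (weingartenTrace (metricInChart (inducedMetric (m := m) ι) p)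
        (inChart ι p) fun z =>
          inChart (m := m) (fun q : UnitSphere m => (q : Euc (m + 1))) (η p)
            (mapInChart (m := m) (n := m) η p z)) z := by
  have h := isUnitNormalField_of_isGaussMap hι hη
  have hU := isOpen_gaussDomain hη.1 p
  rw [inner_partialD_fieldInChart_grad h hz.1]
  congr 1
  refine partialD_congr hU (fun y hy => ?_) l hz
  unfold weingartenTrace weingarten
  simp only [h.metricInChart_eq p hy.1, partialD_congr hU (inChart_mapInChart η p) _ hy]

theorem fderiv_tensionField (hm : m ≠ 0) (hι : IsHypersurface ι) (hη : IsGaussMap ι η) (p : M) :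
    fderiv ℝ (inChart (m := m) (fun q : UnitSphere m => (q : Euc (m + 1))) (η p))
        (mapInChart (m := m) (n := m) η p (extChartAt (𝓡 m) p p))
        (tensionField (inducedMetric (m := m) ι) (sphereMetric m) η p) =
      -(m : ℝ) • mvfderiv (𝓡 m) ι p (grad (inducedMetric (m := m) ι) (meanCurvature ι η) p) := by
  have h := isUnitNormalField_of_isGaussMap hι hη
  have hS := isUnitNormalField_sphere m
  refine ((unitNormalOn_gaussDomain hι hη p).fderiv_tensionCoord_gaussMap
    ((h.metricInChart_eq p).mono Set.inter_subset_left) (hS.unitNormalOn (η p))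
    (hS.metricInChart_eq (η p)) (contDiffOn_mapInChart hη.1 p) (mapsTo_mapInChart η p) hm
    (W := fieldInChart (grad (inducedMetric (m := m) ι) (meanCurvature ι η)) p)
    (fun z hz l => inner_partialD_fieldInChart_grad_gaussDomain hι hη p hz l)
    (mem_gaussDomain η p)).trans ?_
  rw [fderiv_inChart_fieldInChart (mem_extChartAt_target p) (h.mdifferentiableAt _),
    extChartAt_to_inv]

/-- The curvature trace. Each term contains `dη = -dι ∘ A` twice, so the signs cancel;
self-adjointness moves `A` onto `v`, and the first sum is `A` applied to the expansion `hAv` of `A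
v`. -/
theorem sum_inner_smul_partialD_normal (h : IsUnitNormalField ι fun p => (η p : Euc (m + 1)))
    (p : M) (v : TangentSpace (𝓡 m) p) :
    ∑ i, ∑ j, (gramAt (inducedMetric (m := m) ι) p)⁻¹ i j •
        (⟪mvfderiv (𝓡 m) ι p v, mvfderiv (𝓡 m) (fun q => (η q : Euc (m + 1))) p (basisVec p j)⟫ •
            mvfderiv (𝓡 m) (fun q => (η q : Euc (m + 1))) p (basisVec p i)
          - ⟪mvfderiv (𝓡 m) (fun q => (η q : Euc (m + 1))) p (basisVec p i),
              mvfderiv (𝓡 m) (fun q => (η q : Euc (m + 1))) p (basisVec p j)⟫ •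
            mvfderiv (𝓡 m) ι p v) =
      mvfderiv (𝓡 m) ι p (shapeOperator ι η p (shapeOperator ι η p v)
        - normSqEnd (inducedMetric (m := m) ι) p (shapeOperator ι η p) • v) := by
  have hA : ∀ w, mvfderiv (𝓡 m) (fun q => (η q : Euc (m + 1))) p w =
      -mvfderiv (𝓡 m) ι p (shapeOperator ι η p w) := fun w => by
    rw [mvfderiv_shapeOperator h, neg_neg]
  have hAv : shapeOperator ι η p v = ∑ i, ∑ j, ((gramAt (inducedMetric (m := m) ι) p)⁻¹ i j *
      ⟪mvfderiv (𝓡 m) ι p (basisVec p j), mvfderiv (𝓡 m) ι p (shapeOperator ι η p v)⟫) •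
        basisVec p i := by
    apply h.injective p
    conv_lhs => rw [eq_sum_gram_inv (linearIndependent_mvfderiv_basisVec (h.injective p))
      (h.mem_span_basisVec p (h.orthogonal p (shapeOperator ι η p v)))]
    simp only [map_sum, map_smul, gramAt_inducedMetric]
  simp only [smul_sub, Finset.sum_sub_distrib]
  rw [map_sub, map_smul]
  congr 1
  · conv_rhs => rw [hAv]
    simp only [map_sum, map_smul, hA, inner_neg_right, smul_neg, neg_smul, neg_neg, smul_smul,
      ← inner_mvfderiv_shapeOperator_comm h]
    refine Finset.sum_congr rfl fun i _ => Finset.sum_congr rfl fun j _ => ?_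
    rw [real_inner_comm, ← inner_mvfderiv_shapeOperator_comm h]
  · simp only [hA, inner_neg_neg, smul_smul, ← Finset.sum_smul]
    rfl

theorem fderiv_bitensionField (hm : m ≠ 0) (hι : IsHypersurface ι) (hη : IsGaussMap ι η) (p : M) :
    fderiv ℝ (inChart (m := m) (fun q : UnitSphere m => (q : Euc (m + 1))) (η p))
        (mapInChart (m := m) (n := m) η p (extChartAt (𝓡 m) p p))
        (bitensionField (inducedMetric (m := m) ι) (sphereMetric m) η p) =
      (m : ℝ) • mvfderiv (𝓡 m) ι p
        (roughLaplacian (inducedMetric (m := m) ι)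
            (grad (inducedMetric (m := m) ι) (meanCurvature ι η)) p
          + shapeOperator ι η p (shapeOperator ι η p
              (grad (inducedMetric (m := m) ι) (meanCurvature ι η) p))
          - normSqEnd (inducedMetric (m := m) ι) p (shapeOperator ι η p) •
            grad (inducedMetric (m := m) ι) (meanCurvature ι η) p) := by
  have h := isUnitNormalField_of_isGaussMap hι hη
  have hS := isUnitNormalField_sphere m
  refine ((unitNormalOn_gaussDomain hι hη p).fderiv_bitensionCoord_gaussMap
    ((h.metricInChart_eq p).mono Set.inter_subset_left) (hS.unitNormalOn (η p))
    (hS.metricInChart_eq (η p)) (contDiffOn_mapInChart hη.1 p) (mapsTo_mapInChart η p) hm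
    (W := fieldInChart (grad (inducedMetric (m := m) ι) (meanCurvature ι η)) p)
    (fun z hz l => inner_partialD_fieldInChart_grad_gaussDomain hι hη p hz l)
    (mem_gaussDomain η p)).trans ?_
  have hν : ∀ i, partialD i (fun z => inChart (m := m) (fun q : UnitSphere m => (q : Euc (m + 1))) (η p)
      (mapInChart (m := m) (n := m) η p z)) (extChartAt (𝓡 m) p p) =
      mvfderiv (𝓡 m) (fun q => (η q : Euc (m + 1))) p (basisVec p i) := fun i => by
    rw [partialD_congr (isOpen_gaussDomain hη.1 p) (inChart_mapInChart η p) i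
      (mem_gaussDomain η p)]
    exact partialD_inChart_self (h.mdifferentiableAt_normal p) i
  rw [fderiv_inChart_fieldInChart (mem_extChartAt_target p) (h.mdifferentiableAt _),
    extChartAt_to_inv, h.metricInChart_eq p (mem_extChartAt_target p), ← h.gramAt_eq,
    fderiv_inChart_self (h.mdifferentiableAt p)]
  simp only [hν]
  rw [sum_inner_smul_partialD_normal h, add_sub_assoc, map_add]
  rfl

theorem tensionField_eq_zero_iff (hm : m ≠ 0) (hι : IsHypersurface ι) (hη : IsGaussMap ι η)
    (p : M) : tensionField (inducedMetric (m := m) ι) (sphereMetric m) η p = 0 ↔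
      grad (inducedMetric (m := m) ι) (meanCurvature ι η) p = 0 := by
  have h1 := fderiv_tensionField hm hι hη p
  have hinj := ((isUnitNormalField_sphere m).unitNormalOn (η p)).injective _
    (mapsTo_mapInChart η p (mem_gaussDomain η p))
  have hm' : (m : ℝ) ≠ 0 := Nat.cast_ne_zero.2 hm
  constructor
  · intro h0
    rw [h0] at h1
    have h2 := h1.symm.trans (map_zero _)
    exact hι.2 p (((smul_eq_zero.1 h2).resolve_left (neg_ne_zero.2 hm')).trans (map_zero _).symm)
  · intro h0
    rw [h0, map_zero, smul_zero] at h1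
    exact hinj (h1.trans (map_zero _).symm)

theorem bitensionField_eq_zero_iff (hm : m ≠ 0) (hι : IsHypersurface ι) (hη : IsGaussMap ι η)
    (p : M) : bitensionField (inducedMetric (m := m) ι) (sphereMetric m) η p = 0 ↔
      roughLaplacian (inducedMetric (m := m) ι)
            (grad (inducedMetric (m := m) ι) (meanCurvature ι η)) p
          + shapeOperator ι η p (shapeOperator ι η p
              (grad (inducedMetric (m := m) ι) (meanCurvature ι η) p))
          - normSqEnd (inducedMetric (m := m) ι) p (shapeOperator ι η p) •
            grad (inducedMetric (m := m) ι) (meanCurvature ι η) p = 0 := by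
  have h1 := fderiv_bitensionField hm hι hη p
  have hinj := ((isUnitNormalField_sphere m).unitNormalOn (η p)).injective _
    (mapsTo_mapInChart η p (mem_gaussDomain η p))
  have hm' : (m : ℝ) ≠ 0 := Nat.cast_ne_zero.2 hm
  constructor
  · intro h0
    rw [h0] at h1
    have h2 := h1.symm.trans (map_zero _)
    exact hι.2 p (((smul_eq_zero.1 h2).resolve_left hm').trans (map_zero _).symm)
  · intro h0
    rw [h0, map_zero, smul_zero] at h1
    exact hinj (h1.trans (map_zero _).symm)

end GaussMapTension

end

end BiharmonicGauss

theorem mainTheorem2 {m : ℕ} {M : Type*} [TopologicalSpace M]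
    [ChartedSpace (BiharmonicGauss.Euc m) M] [IsManifold (𝓡 m) ∞ M]
    (ι : M → BiharmonicGauss.Euc (m + 1)) (η : M → BiharmonicGauss.UnitSphere m)
    (hι : BiharmonicGauss.IsHypersurface ι) (hη : BiharmonicGauss.IsGaussMap ι η)
    (hmin : ¬ BiharmonicGauss.IsMinimal ι η) :
    let g := BiharmonicGauss.inducedMetric (m := m) ι
    let f := BiharmonicGauss.meanCurvature ι η
    let A := BiharmonicGauss.shapeOperator ι η
    let gradf := BiharmonicGauss.grad g f
    BiharmonicGauss.IsProperBiharmonic g (BiharmonicGauss.sphereMetric m) η ↔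
      gradf ≠ 0 ∧
        ∀ p, BiharmonicGauss.roughLaplacian g gradf p + A p (A p (gradf p))
          - BiharmonicGauss.normSqEnd g p (A p) • gradf p = 0 := by
  intro g f A gradf
  have hm : m ≠ 0 := by
    rintro rfl
    -- For `m = 0` the factor `1 / m` is `0`, so the mean curvature vanishes. Non-minimality enters
    -- the proof only here.
    exact hmin fun p => by simp [BiharmonicGauss.meanCurvature]
  have hharm : BiharmonicGauss.IsHarmonic g (BiharmonicGauss.sphereMetric m) η ↔ gradf = 0 := by
    unfold BiharmonicGauss.IsHarmonic
    rw [and_iff_right hη.1, funext_iff]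
    exact forall_congr' fun p => BiharmonicGauss.tensionField_eq_zero_iff hm hι hη p
  have hbi : BiharmonicGauss.IsBiharmonic g (BiharmonicGauss.sphereMetric m) η ↔
      ∀ p, BiharmonicGauss.roughLaplacian g gradf p + A p (A p (gradf p))
        - BiharmonicGauss.normSqEnd g p (A p) • gradf p = 0 := by
    unfold BiharmonicGauss.IsBiharmonic
    rw [and_iff_right hη.1]
    exact forall_congr' fun p => BiharmonicGauss.bitensionField_eq_zero_iff hm hι hη p
  unfold BiharmonicGauss.IsProperBiharmonic
  rw [hharm, hbi, and_comm]
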